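/- **Setting.** Let $\mathcal A,\mathcal O$ be countable sets of actions and observations, $L\ge 0$, $\mathcal R\subset[-L,1]$ a countable set of rewards, and $\gamma\in(0,1)$. A history $h_{<t}$ is a finite sequence of triples $(a_s,o_s,r_s)_{s<t}$. A policy $\pi$ assigns to each history a probability distribution of the next action. An environment $\nu$ assigns to each history and action a sub-probability distribution $\nu(\cdot\mid h_{<t}a_t)$ on percepts $(o_t,r_t)\in\mathcal O\times\mathcal R$; the missing mass is the probability that the interaction ends, and undefined rewards count as $0$. Write $\mathbb P_\nu^\pi$ for the law of the interaction, $V_\nu^\pi(h_{<t})=\mathbb E_\nu^\pi[(1-\gamma)\sum_{s\ge0}\gamma^s r_{t+s}\mid h_{<t}]$ and $V_\nu^*=\sup_\pi V_\nu^\pi$. Let $\xi$ be the Bayesian mixture of countably many environments $\nu$ with weights $w_\nu>0$, $\sum_\nu w_\nu\le1$, that is, the environment with $\prod_{s\le t}\xi(o_sr_s\mid h_{<s}a_s)=\sum_\nu w_\nu\prod_{s\le t}\nu(o_sr_s\mid h_{<s}a_s)$ for all $t\ge1$. Assume that there is a policy $\pi_\xi^*$ with $V_\xi^{\pi_\xi^*}(h)=V_\xi^*(h)$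 for all histories $h$, and fix one. Let $\mathcal T$ be a family of policies (mentors) with weights $w_\tau\ge0$, $\sum_{\tau\in\mathcal T}w_\tau=1$, and let $\mathcal T_\delta=\{\tau\in\mathcal T: w_\tau\ge\delta\}$. **The Golden Handcuffs policy $\pi^{\mathrm{GH}}$**, with $\eta(t)=t^{-1/3}$ and $H(t)=\left\lceil\frac{\ln t}{6(1-\gamma)}\right\rceil$, has an internal state $\sigma_t$ at the start of each step $t=1,2,\dots$: either $\sigma_t=0$ (not exploring), or $\sigma_t=(n,\tau)$ (the next $n\geq 1$ actions are sampled from the mentor $\tau$); $\sigma_1=0$. At step $t$, if $\sigma_t=0$, then (1) if $V_\xi^*(h_{<t})\le-1$, the state is set to $(1,\tau)$ for an arbitrary mentor $\tau$ (chosen, possibly at random, depending on $h_{<t}$); and then (2) with probability $\eta(t)$, the state is instead set to $(H(t),\tau)$ with $\tau$ sampled with the probabilities $w_\tau$ (here $(0,\tau)$ means $0$). If the state is now $(n,\tau)$ with $n\ge1$, the action is sampled from $\tau(h_{<t})$ and $n$ decreases by one; otherwise the action is sampled from $\pi_\xi^*(h_{<t})$. Write $V_\nu^{\pi^{\mathrm{GH}}}(h_{<t},\sigma_t)$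 for the value of continuing from history $h_{<t}$ in state $\sigma_t$, and $V_\nu^{\pi^{\mathrm{GH}}}(h_{<t})=\mathbb E_\nu^{\pi^{\mathrm{GH}}}[V_\nu^{\pi^{\mathrm{GH}}}(h_{<t},\sigma_t)\mid h_{<t}]$. **Theorem (Capability).** Let the true environment $\mu$ be one of the environments in the mixture, with weight $w_\mu$, whose percept probabilities $\mu(\cdot\mid h_{<t}a_t)$ always sum to $1$, and suppose that $\mathbb P_\mu^{\pi^{\mathrm{GH}}}(\forall t\ge1,\ r_t\ge0)=1$. Then for all $\epsilon>0$ and all $T\in\mathbb N$, $$\begin{aligned} &\mathbb E_\mu^{\pi^{\mathrm{GH}}}\left[\sum_{t=1}^T\left(\max_{\tau\in\mathcal T_\epsilon\cup\{\pi^{\mathrm{GH}}\}}V_\mu^{\tau}(h_{<t})-V_\mu^{\pi^{\mathrm{GH}}}(h_{<t})\right)^2\right]\\ &\le\mathbb E_\mu^{\pi^{\mathrm{GH}}}\left[\sum_{t=1}^T\max\left(0,\ \max_{\tau\in\mathcal T_\epsilon}V_\mu^{\tau}(h_{<t})-V_\mu^{\pi^{\mathrm{GH}}}(h_{<t},\sigma_t)\right)^2\right]\\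 &\le\frac{1}{4(1-\gamma)}T^{2/3}\ln T+\frac{12(L+1)^2}{(1-\gamma)^2}T^{1/3}+\frac{8L(L+1)^2}{(1-\gamma)^3}\ln\frac1{w_\mu}+\frac{4(L+2)^2}{\epsilon^2}T^{2/3}\ln\frac1{w_\mu}+6(L+1)^2T^{2/3} \end{aligned}$$ (with $\max\emptyset=-\infty$, and $T^{2/3}\ln T=0$ for $T=0$). Moreover, for all $\epsilon>0$, $$\lim_{T\to\infty}\frac{\mathbb E_\mu^{\pi^{\mathrm{GH}}}\left[\#\left\{t\le T:\ \max_{\tau\in\mathcal T_{\epsilon/\log_2T}}V_\mu^{\tau}(h_{<t})-V_\mu^{\pi^{\mathrm{GH}}}(h_{<t})\ge\epsilon\right\}\right]}{T^{2/3+\epsilon}}=0.$$ -/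

import Mathlib

open MeasureTheory ProbabilityTheory Filter Topology
open scoped NNReal ENNReal

noncomputable section

namespace GoldenHandcuffs

/-! ### Histories, environments, policies -/

/-- Finite interaction histories. Each entry consists of an action, an observation and a reward
(an element of the reward set `R`). Entries are listed with the MOST RECENT step first, so that
`(a, e) :: h` is the history `h` extended by the action `a` and the percept `e`.
The history `h_{<t}` preceding time `t` has length `t - 1`. -/
abbrev Hist (A O : Type*) (R : Set ℝ) := List (A × O × R)

/-- A (chronological, semimeasure) environment: a conditional sub-probability of the next percept
(observation, reward) given the history and the current action. The missing mass is the probability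
that no percept is emitted, in which case the interaction ends. -/
structure Environment (A O : Type*) (R : Set ℝ) where
  prob : Hist A O R → A → O × R → ℝ≥0∞
  tsum_le_one : ∀ h a, ∑' e, prob h a e ≤ 1

/-- A stochastic policy. -/
abbrev Policy (A O : Type*) (R : Set ℝ) := Hist A O R → PMF A

/-- A policy with an internal state in `S`: given the history and the current internal state, it
jointly samples the action and the next internal state. -/
abbrev Agent (A O : Type*) (R : Set ℝ) (S : Type*) := Hist A O R → S → PMF (A × S)

variable {A O S N ι : Type*} {R : Set ℝ}

/-- A policy is an agent without internal state. -/
def Policy.toAgent (π : Policy A O R) : Agent A O R Unit :=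
  fun h _ => (π h).map fun a => (a, ())

namespace Environment

/-- The environment never stops emitting percepts: its conditional probabilities sum to one. -/
def IsProper (ν : Environment A O R) : Prop := ∀ h a, ∑' e, ν.prob h a e = 1

/-- The next percept as a probability distribution; `none` means that the interaction ends. -/
def percept (ν : Environment A O R) (h : Hist A O R) (a : A) : PMF (Option (O × R)) :=
  ⟨fun o => o.elim (1 - ∑' e, ν.prob h a e) (ν.prob h a), by
    classical
    have key (c : ℝ≥0∞) (f : O × R → ℝ≥0∞) :
        ∑' o : Option (O × R), o.elim c f = c + ∑' e, f e := by
      rw [ENNReal.tsum_eq_add_tsum_ite none, ← (Option.some_injective (O × R)).tsum_eq]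
      · simp
      · rintro (_ | e) ho
        · simp at ho
        · exact ⟨e, rfl⟩
    rw [ENNReal.summable.hasSum_iff, key, tsub_add_cancel_of_le (ν.tsum_le_one h a)]⟩

/-- The causal probability `ν(or_{1:T} ‖ a_{1:T}) = ∏ₜ ν(oₜrₜ | h_{<t} aₜ)` of the percepts of a
history, when its actions are held fixed. -/
def causal (ν : Environment A O R) : Hist A O R → ℝ≥0∞
  | [] => 1
  | (a, e) :: h => ν.causal h * ν.prob h a e

end Environment

/-! ### The Bayesian mixture -/

/-- Causal probability of the percepts of a history under the mixture of the models `M n` with the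
weights `w n`. (The empty history has probability one; if the weights do not sum to one, then the
missing weight is the probability that the mixture never emits any percept.) -/
def mixCausal (M : N → Environment A O R) (w : N → ℝ≥0) : Hist A O R → ℝ≥0∞
  | [] => 1
  | x :: h => ∑' n, (w n : ℝ≥0∞) * (M n).causal (x :: h)

theorem tsum_mixCausal_cons_le (M : N → Environment A O R) (w : N → ℝ≥0)
    (hw : ∑' n, (w n : ℝ≥0∞) ≤ 1) (h : Hist A O R) (a : A) :
    ∑' e, mixCausal M w ((a, e) :: h) ≤ mixCausal M w h := by
  have key : ∑' e, mixCausal M w ((a, e) :: h) ≤ ∑' n, (w n : ℝ≥0∞) * (M n).causal h := by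
    simp only [mixCausal, Environment.causal]
    rw [ENNReal.tsum_comm]
    refine ENNReal.tsum_le_tsum fun n => ?_
    simp_rw [← mul_assoc]
    rw [ENNReal.tsum_mul_left]
    exact mul_le_of_le_one_right' ((M n).tsum_le_one h a)
  refine key.trans ?_
  cases h with
  | nil => simpa [mixCausal, Environment.causal] using hw
  | cons x h => exact le_rfl

/-- The Bayesian mixture environment `ξ`: its causal probabilities are the weighted sums of those
of the models, so its conditional probabilities are the corresponding ratios. -/
def mixture (M : N → Environment A O R) (w : N → ℝ≥0) (hw : ∑' n, (w n : ℝ≥0∞) ≤ 1) :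
    Environment A O R where
  prob h a e := mixCausal M w ((a, e) :: h) / mixCausal M w h
  tsum_le_one h a := by
    simp_rw [div_eq_mul_inv]
    rw [ENNReal.tsum_mul_right, ← div_eq_mul_inv]
    exact ENNReal.div_le_of_le_mul (by simpa using tsum_mixCausal_cons_le M w hw h a)

/-! ### The interaction of an agent with an environment -/

/-- The situation between two time steps: either the interaction has ended, or it is running, with
the history so far and the current internal state of the agent. -/
inductive Node (A O : Type*) (R : Set ℝ) (S : Type*)
  | ended : Node A O R S
  | running (h : Hist A O R) (s : S) : Node A O R S

instance : MeasurableSpace (Node A O R S) := ⊤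

instance : DiscreteMeasurableSpace (Node A O R S) := ⟨fun _ => trivial⟩

/-- The most recent reward, with default value `0` if there is none. -/
def Node.reward : Node A O R S → ℝ
  | .running ((_, _, r) :: _) _ => r
  | _ => 0

/-- One time step: the agent samples its action (and its next internal state), then the environment
samples a percept, or ends the interaction. -/
def step (ν : Environment A O R) (ag : Agent A O R S) : Node A O R S → PMF (Node A O R S)
  | .ended => PMF.pure .ended
  | .running h s => (ag h s).bind fun as => (ν.percept h as.1).map fun o =>
      o.elim .ended fun e => .running ((as.1, e) :: h) as.2

/-- The transition kernel of a discrete Markov chain. -/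
def chainKernel {X : Type*} [MeasurableSpace X] [DiscreteMeasurableSpace X] (f : X → PMF X) :
    Kernel X X where
  toFun x := (f x).toMeasure
  measurable' := Measurable.of_discrete

instance {X : Type*} [MeasurableSpace X] [DiscreteMeasurableSpace X] (f : X → PMF X) :
    IsMarkovKernel (chainKernel f) :=
  ⟨fun x => inferInstanceAs (IsProbabilityMeasure (f x).toMeasure)⟩

/-- The law, on infinite trajectories, of the Markov chain started at `x` with transitions `f`. -/
def chainLaw {X : Type*} [MeasurableSpace X] [DiscreteMeasurableSpace X] (f : X → PMF X) (x : X) :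
    Measure (ℕ → X) :=
  Kernel.traj (X := fun _ : ℕ => X)
    (fun n : ℕ => (chainKernel f).comap (fun y => y ⟨n, Finset.mem_Iic.2 le_rfl⟩) (by fun_prop)) 0
    (fun _ => x)

/-- The law of the interaction of an agent with the environment `ν`, continued from the history `h`
and the internal state `s`. Coordinate `k` is the situation after `k` further time steps. -/
def law (ν : Environment A O R) (ag : Agent A O R S) (h : Hist A O R) (s : S) :
    Measure (ℕ → Node A O R S) :=
  chainLaw (step ν ag) (.running h s)

/-! ### Value functions -/

/-- `V_ν^π(h, s)`: the expected normalized discounted sum of future rewards of an agent that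
continues from the history `h` in the internal state `s`. -/
def value (γ : ℝ) (ν : Environment A O R) (ag : Agent A O R S) (h : Hist A O R) (s : S) : ℝ :=
  ∫ ω, (1 - γ) * ∑' k : ℕ, γ ^ k * (ω (k + 1)).reward ∂(law ν ag h s)

/-- `V_ν^π(h)` for a policy `π`. -/
def policyValue (γ : ℝ) (ν : Environment A O R) (π : Policy A O R) (h : Hist A O R) : ℝ :=
  value γ ν π.toAgent h ()

/-- `V_ν^π(h)` for an agent with internal state that starts in state `s₀` at the empty history: the
conditional expectation of `V_ν^π(h, σ)`, over the internal state `σ` at the history `h`, given that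
the history `h` occurs. -/
def marginalValue (γ : ℝ) (ν : Environment A O R) (ag : Agent A O R S) (s₀ : S)
    (h : Hist A O R) : ℝ :=
  ∫ ω, (match ω h.length with
      | .ended => 0
      | .running h' s => value γ ν ag h' s)
    ∂((law ν ag [] s₀)[|{ω | ∃ s, ω h.length = .running h s}])

/-- `V_ξ^*(h)`: the supremum of `V_ξ^π(h)` over all policies. -/
def optValue (γ : ℝ) (ξ : Environment A O R) (h : Hist A O R) : ℝ :=
  ⨆ π : Policy A O R, policyValue γ ξ π h

/-- `π` attains `V_ξ^*(h)` at every history `h`. -/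
def IsBayesOptimal (γ : ℝ) (ξ : Environment A O R) (π : Policy A O R) : Prop :=
  ∀ (h : Hist A O R) (π' : Policy A O R), policyValue γ ξ π' h ≤ policyValue γ ξ π h

/-! ### The Golden Handcuffs agent -/

/-- Internal states of the agent: `none` if it is not exploring, and `some (n, i)` if the next `n`
actions will be sampled from the mentor `i`. -/
abbrev RolloutState (ι : Type*) := Option (ℕ+ × ι)

/-- The state in which `n` actions of the mentor `i` remain to be taken. -/
def rollout : ℕ → ι → RolloutState ι
  | 0, _ => none
  | n + 1, i => some (n.succPNat, i)

/-- A coin that shows `true` with probability `p`. -/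
def coin (p : ℝ≥0) (hp : p ≤ 1) : PMF Bool :=
  PMF.ofFintype (fun b => bif b then (p : ℝ≥0∞) else 1 - p) (by
    simpa using add_tsub_cancel_of_le (ENNReal.coe_le_one_iff.2 hp))

/-- The exploration probability `η(t) = t^{-1/3}`. -/
def eta (t : ℕ) : ℝ≥0 := (t : ℝ≥0) ^ (-(1 / 3) : ℝ)

theorem eta_le_one (t : ℕ) : eta t ≤ 1 := by
  rcases Nat.eq_zero_or_pos t with rfl | ht
  · simp [eta]
  · exact NNReal.rpow_le_one_of_one_le_of_nonpos (by exact_mod_cast ht) (by norm_num)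

/-- The number of steps of an exploratory rollout: `H(t) = ln t / (6 (1 - γ))`, rounded up. -/
def horizon (γ : ℝ) (t : ℕ) : ℕ := ⌈Real.log t / (6 * (1 - γ))⌉₊

open Classical in
/-- The update of the internal state at the start of time step `t = |h| + 1`. If no rollout is in
progress, then (1) if `V_ξ^*(h) ≤ -1`, control is yielded for one step to a mentor, chosen in an
arbitrary way (described by `yieldTo`); and (2) with probability `η(t)`, a rollout of `H(t)` steps
begins, of a random mentor with distribution `v`. -/
def trigger (γ : ℝ) (ξ : Environment A O R) (v : PMF ι) (yieldTo : Hist A O R → PMF ι)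
    (h : Hist A O R) : RolloutState ι → PMF (RolloutState ι)
  | some x => PMF.pure (some x)
  | none =>
      (coin (eta (h.length + 1)) (eta_le_one _)).bind fun b =>
        if b then v.map (rollout (horizon γ (h.length + 1)))
        else if optValue γ ξ h ≤ -1 then (yieldTo h).map (rollout 1)
        else PMF.pure none

/-- Sampling an action: from the mentor in control if there is one (decreasing the number of
remaining rollout steps), and from the optimizing policy `πopt` otherwise. -/
def act (πopt : Policy A O R) (mentor : ι → Policy A O R) (h : Hist A O R) :
    RolloutState ι → PMF (A × RolloutState ι)
  | some (n, i) => (mentor i h).map fun a => (a, rollout ((n : ℕ) - 1) i)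
  | none => (πopt h).map fun a => (a, none)

/-- The Golden Handcuffs agent `π^GH`. -/
def agentGH (γ : ℝ) (ξ : Environment A O R) (πopt : Policy A O R) (mentor : ι → Policy A O R)
    (v : PMF ι) (yieldTo : Hist A O R → PMF ι) : Agent A O R (RolloutState ι) :=
  fun h σ => (trigger γ ξ v yieldTo h σ).bind (act πopt mentor h)

/-! ### Comparison with the mentors -/

/-- `max_{τ ∈ T_ε ∪ {π^GH}} V_μ^τ(h) - V_μ^{π^GH}(h)`, where `T_ε` is the (finite) set of the
mentors of weight at least `ε`. -/
def shortfall (γ : ℝ) (μ : Environment A O R) (GH : Agent A O R (RolloutState ι))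
    (mentor : ι → Policy A O R) (v : PMF ι) (ε : ℝ) : Node A O R (RolloutState ι) → ℝ
  | .ended => 0
  | .running h _ =>
      sSup (insert (marginalValue γ μ GH none h)
        ((fun i => policyValue γ μ (mentor i) h) '' {i | ε ≤ (v i).toReal}))
      - marginalValue γ μ GH none h

/-- `max (0, max_{τ ∈ T_ε} V_μ^τ(h) - V_μ^{π^GH}(h, σ))`, read as `0` if `T_ε` is empty. -/
def stateShortfall (γ : ℝ) (μ : Environment A O R) (GH : Agent A O R (RolloutState ι))
    (mentor : ι → Policy A O R) (v : PMF ι) (ε : ℝ) : Node A O R (RolloutState ι) → ℝ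
  | .ended => 0
  | .running h σ =>
      sSup (insert 0
        ((fun i => policyValue γ μ (mentor i) h - value γ μ GH h σ) '' {i | ε ≤ (v i).toReal}))

/-- `max_{τ ∈ T_δ} V_μ^τ(h) - V_μ^{π^GH}(h) ≥ ε`: some mentor of weight at least `δ` is better by at
least `ε`. -/
def FallsBehind (γ : ℝ) (μ : Environment A O R) (GH : Agent A O R (RolloutState ι))
    (mentor : ι → Policy A O R) (v : PMF ι) (δ ε : ℝ) : Node A O R (RolloutState ι) → Prop
  | .ended => False
  | .running h _ => ∃ i, δ ≤ (v i).toReal ∧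
      ε ≤ policyValue γ μ (mentor i) h - marginalValue γ μ GH none h

end GoldenHandcuffs

end

/-! Rewards are shifted by `L`, so that values become expectations in `ℝ≥0∞` (`value_eq`). Let z be
the likelihood ratio ξ/μ of the percepts so far. Under μ it is a supermartingale
(`expect_step_ratio_le`), and z ≥ w_μ. Hence log z + ln(1/w_μ) is a nonnegative potential that
starts at ln(1/w_μ). Its expected decrease over k steps, `infoGain`, dominates the divergence E[z'/z
- 1 - log(z'/z)], and the expected decreases sum over time to at most k ln(1/w_μ)
(`sum_expect_infoGain_le`). A Pinsker-type bound (`deficit_sq_le`) makes the square root of twice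
the divergence control the error of exchanging μ and ξ in expectations of bounded functions.

At a history reached in state `none`, a mentor τ of weight at least ε is compared with the agent in
stages. V_μ^τ is close to V_ξ^τ: a rollout of τ begins with probability at least η(t)ε, so within
the horizon the divergence along τ is at most the agent's information gain divided by η(t)ε, while
later rewards carry the weight γ^H (`shiftedValue_mentor_le`, which also uses V_ξ^τ ≤ V_ξ^*). V_ξ^*
exceeds the agent's value in μ by at most a discounted sum of exploration probabilities, safety
triggers and roots of one-step information gains; this comes from unrolling the Bellman equation
while the agent follows the optimal policy (`excess_le`). Safety triggers are rare: the true rewards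
are nonnegative, so V_ξ^* ≤ -1 forces `L` times the discounted information gain to be at least 1
(`yields_le`). During a rollout the shortfall is at most 1, because the agent's true value is
nonnegative, and the expected number of such steps is at most ∑ η(t)(H(t) - 1)
(`sum_expect_inRollout_le`).

Squaring and summing (`sum_expect_stateShortfall_sq_le`) leaves sums of t^{-1/3} and t^{-2/3}.
Averaging over the hidden state by Jensen (`integral_shortfall_sq_le`) gives the first inequality.
Markov's inequality with the weight threshold ε/log₂ T gives the limit, since T^ε absorbs the
logarithms. -/

namespace GoldenHandcuffs

/-! ### Expectations of nonnegative functions under a `PMF`. -/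

section Expectation

variable {X Y : Type*}

/-- The expectation of a nonnegative function. -/
noncomputable def expect (p : PMF X) (F : X → ℝ≥0∞) : ℝ≥0∞ := ∑' x, p x * F x

theorem expect_mono_support {p : PMF X} {F G : X → ℝ≥0∞} (h : ∀ x, p x ≠ 0 → F x ≤ G x) :
    expect p F ≤ expect p G := by
  refine ENNReal.tsum_le_tsum fun x => ?_
  by_cases hx : p x = 0
  · simp [hx]
  · gcongr
    exact h x hx

theorem expect_mono {p : PMF X} {F G : X → ℝ≥0∞} (h : ∀ x, F x ≤ G x) :
    expect p F ≤ expect p G :=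
  expect_mono_support fun x _ => h x

theorem expect_congr_support {p : PMF X} {F G : X → ℝ≥0∞} (h : ∀ x, p x ≠ 0 → F x = G x) :
    expect p F = expect p G :=
  le_antisymm (expect_mono_support fun x hx => (h x hx).le)
    (expect_mono_support fun x hx => (h x hx).ge)

theorem expect_add (p : PMF X) (F G : X → ℝ≥0∞) :
    expect p (fun x => F x + G x) = expect p F + expect p G := by
  simp only [expect, mul_add, ENNReal.tsum_add]

theorem expect_const_mul (p : PMF X) (c : ℝ≥0∞) (F : X → ℝ≥0∞) :
    expect p (fun x => c * F x) = c * expect p F := by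
  simp only [expect, mul_left_comm _ c, ENNReal.tsum_mul_left]

@[simp] theorem expect_const (p : PMF X) (c : ℝ≥0∞) : expect p (fun _ => c) = c := by
  simp only [expect, ENNReal.tsum_mul_right, p.tsum_coe, one_mul]

theorem expect_le_const {p : PMF X} {F : X → ℝ≥0∞} {c : ℝ≥0∞} (h : ∀ x, F x ≤ c) :
    expect p F ≤ c :=
  (expect_mono h).trans (expect_const p c).le

theorem expect_tsum {κ : Type*} (p : PMF X) (F : κ → X → ℝ≥0∞) :
    expect p (fun x => ∑' k, F k x) = ∑' k, expect p (F k) := by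
  simp only [expect, ← ENNReal.tsum_mul_left]
  exact ENNReal.tsum_comm

theorem expect_finset_sum {κ : Type*} (p : PMF X) (s : Finset κ) (F : κ → X → ℝ≥0∞) :
    expect p (fun x => ∑ k ∈ s, F k x) = ∑ k ∈ s, expect p (F k) := by
  classical
  induction s using Finset.induction_on with
  | empty => simp
  | insert a s ha ih => simp only [Finset.sum_insert ha, expect_add, ih]

@[simp] theorem expect_pure (x : X) (F : X → ℝ≥0∞) : expect (PMF.pure x) F = F x := by
  classical
  rw [expect, tsum_eq_single x]
  · simp
  · intro y hy
    simp [hy]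

@[simp] theorem expect_bind (p : PMF X) (f : X → PMF Y) (F : Y → ℝ≥0∞) :
    expect (p.bind f) F = expect p fun x => expect (f x) F := by
  simp only [expect, PMF.bind_apply, ← ENNReal.tsum_mul_left, ← ENNReal.tsum_mul_right, mul_assoc]
  exact ENNReal.tsum_comm

@[simp] theorem expect_map (p : PMF X) (f : X → Y) (F : Y → ℝ≥0∞) :
    expect (p.map f) F = expect p fun x => F (f x) := by
  simp [← PMF.bind_pure_comp]

theorem mul_le_expect (p : PMF X) (F : X → ℝ≥0∞) (x : X) : p x * F x ≤ expect p F :=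
  ENNReal.le_tsum x

theorem expect_eq_zero {p : PMF X} {F : X → ℝ≥0∞} :
    expect p F = 0 ↔ ∀ x, p x ≠ 0 → F x = 0 := by
  simp [expect, ENNReal.tsum_eq_zero, or_iff_not_imp_left]

/-- The space may be uncountable; a sum suffices because a `PMF` has countable support. -/
theorem lintegral_toMeasure [MeasurableSpace X] [DiscreteMeasurableSpace X] (p : PMF X)
    (F : X → ℝ≥0∞) : ∫⁻ x, F x ∂p.toMeasure = expect p F := by
  rw [← p.restrict_toMeasure_support, lintegral_countable F p.support_countable, expect,
    ← tsum_subtype_eq_of_support_subset (s := p.support)]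
  · refine tsum_congr fun x => ?_
    rw [PMF.toMeasure_apply_singleton _ _ (MeasurableSet.of_discrete), mul_comm]
  · intro x hx
    simp only [Function.mem_support, ne_eq, mul_eq_zero, not_or] at hx
    exact hx.1

/-- The Cauchy-Schwarz inequality for weighted sums. -/
theorem tsum_mul_sq_le {κ : Type*} (c x : κ → ℝ≥0∞) :
    (∑' k, c k * x k) ^ 2 ≤ (∑' k, c k) * ∑' k, c k * x k ^ 2 := by
  set a := ∑' k, c k * x k
  set S := ∑' k, c k * x k ^ 2
  set C := ∑' k, c k
  have key (t : ℝ≥0∞) : 2 * t * a ≤ S + t ^ 2 * C := by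
    rw [← ENNReal.tsum_mul_left, ← ENNReal.tsum_mul_left, ← ENNReal.tsum_add]
    refine ENNReal.tsum_le_tsum fun k => ?_
    have h2 : 2 * t * x k ≤ x k ^ 2 + t ^ 2 := by
      by_cases hx : x k = ⊤
      · simp [hx]
      by_cases ht : t = ⊤
      · simp [ht]
      lift x k to ℝ≥0 using hx with y
      lift t to ℝ≥0 using ht
      norm_cast
      rw [← NNReal.coe_le_coe]
      push_cast
      nlinarith [sq_nonneg ((y : ℝ) - t)]
    calc 2 * t * (c k * x k) = c k * (2 * t * x k) := by ring
      _ ≤ c k * (x k ^ 2 + t ^ 2) := by gcongr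
      _ = _ := by ring
  by_cases hC0 : C = 0
  · have : a = 0 := by
      simp only [C, ENNReal.tsum_eq_zero] at hC0
      simp [a, hC0]
    simp [this]
  by_cases hS0 : S = 0
  · have : a = 0 := by
      simp only [S, ENNReal.tsum_eq_zero, mul_eq_zero, pow_eq_zero_iff two_ne_zero] at hS0
      simp only [a, ENNReal.tsum_eq_zero, mul_eq_zero]
      exact hS0
    simp [this]
  by_cases hC : C = ⊤
  · simp [hC, ENNReal.top_mul hS0]
  by_cases hS : S = ⊤
  · simp [hS, ENNReal.mul_top hC0]
  have ha : a ≠ ⊤ := by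
    intro ha
    have := key 1
    rw [ha] at this
    simp [hC, hS] at this
  -- The value of `t` at which the quadratic bound `key` is sharpest.
  have h3 := key (a / C)
  lift a to ℝ≥0 using ha with a'
  lift S to ℝ≥0 using hS with S'
  lift C to ℝ≥0 using hC with C'
  have hC' : C' ≠ 0 := by simpa using hC0
  rw [← ENNReal.coe_div hC'] at h3
  norm_cast at h3 ⊢
  rw [← NNReal.coe_le_coe] at h3 ⊢
  push_cast at h3 ⊢
  have hCp : (0 : ℝ) < C' := by positivity
  have e1 : 2 * ((a' : ℝ) / C') * a' = 2 * (a' ^ 2 / C') := by ring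
  have e2 : ((a' : ℝ) / C') ^ 2 * C' = a' ^ 2 / C' := by field_simp
  rw [e1, e2] at h3
  have : (a' : ℝ) ^ 2 / C' ≤ S' := by linarith
  rwa [div_le_iff₀ hCp, mul_comm] at this

theorem expect_sq_le (p : PMF X) (F : X → ℝ≥0∞) :
    expect p F ^ 2 ≤ expect p fun x => F x ^ 2 := by
  simpa [p.tsum_coe, expect] using tsum_mul_sq_le p F

end Expectation

/-! ### Markov chains: from trajectories to `n`-step distributions. -/

section Chain

variable {X : Type*}

/-- The distribution of a Markov chain with transitions `f`, started at `x`, after `n` steps. -/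
noncomputable def iter (f : X → PMF X) : ℕ → X → PMF X
  | 0, x => PMF.pure x
  | n + 1, x => (f x).bind (iter f n)

theorem iter_add (f : X → PMF X) (m n : ℕ) (x : X) :
    iter f (m + n) x = (iter f m x).bind (iter f n) := by
  induction m generalizing x with
  | zero => simp [iter]
  | succ m ih =>
    simp only [Nat.succ_add, iter, PMF.bind_bind]
    congr 1
    funext y
    exact ih y

theorem iter_one (f : X → PMF X) (x : X) : iter f 1 x = f x := by
  simp only [iter]
  exact PMF.bind_pure _

theorem iter_succ' (f : X → PMF X) (n : ℕ) (x : X) :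
    iter f (n + 1) x = (iter f n x).bind f := by
  rw [iter_add]
  congr 1
  funext y
  exact iter_one f y

theorem iter_pos_trans {f : X → PMF X} {m n : ℕ} {x y z : X} (hy : iter f m x y ≠ 0)
    (hz : iter f n y z ≠ 0) : iter f (m + n) x z ≠ 0 := by
  rw [iter_add, ← PMF.mem_support_iff, PMF.mem_support_bind_iff]
  exact ⟨y, hy, hz⟩

variable [MeasurableSpace X] [DiscreteMeasurableSpace X]

instance (f : X → PMF X) (x : X) : IsProbabilityMeasure (chainLaw f x) := by
  unfold chainLaw
  infer_instance

/-- Conditionally on the coordinates up to `n`, the next one is drawn from a kernel that looks at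
coordinate `n` only. -/
theorem lintegral_chainLaw_succ (f : X → PMF X) (x : X) (n : ℕ) (F : X → ℝ≥0∞) :
    ∫⁻ ω, F (ω (n + 1)) ∂chainLaw f x = ∫⁻ ω, expect (f (ω n)) F ∂chainLaw f x := by
  have hF : Measurable F := Measurable.of_discrete
  have hG : Measurable fun y => expect (f y) F := Measurable.of_discrete
  unfold chainLaw
  set κ := fun n : ℕ => (chainKernel f).comap
    (fun y : (Π _ : Finset.Iic n, X) => y ⟨n, Finset.mem_Iic.2 le_rfl⟩) (by fun_prop) with hκ
  have h1 := Kernel.traj_comp_partialTraj (X := fun _ : ℕ => X) (κ := κ) (Nat.zero_le n)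
  rw [← h1, Kernel.lintegral_comp _ _ _ (by fun_prop), h1, ← Kernel.traj_map_frestrictLe,
    Kernel.lintegral_map _ (by fun_prop) _ ?_]
  · refine lintegral_congr fun ω => ?_
    have h2 := Kernel.map_traj_succ_self (X := fun _ : ℕ => X) (κ := κ) (a := n)
    have h3 := congrArg (fun k => ∫⁻ z, F z ∂(k (Preorder.frestrictLe n ω))) h2
    rw [Kernel.lintegral_map _ (by fun_prop) _ hF] at h3
    rw [h3, hκ, Kernel.comap_apply]
    exact lintegral_toMeasure _ _
  · exact Measurable.lintegral_kernel (by fun_prop)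

theorem lintegral_chainLaw_zero (f : X → PMF X) (x : X) (F : X → ℝ≥0∞) :
    ∫⁻ ω, F (ω 0) ∂chainLaw f x = F x := by
  have hF : Measurable F := Measurable.of_discrete
  unfold chainLaw
  rw [Kernel.lintegral_traj _ (by fun_prop)]
  simp [Function.updateFinset]

theorem lintegral_chainLaw (f : X → PMF X) (x : X) (n : ℕ) (F : X → ℝ≥0∞) :
    ∫⁻ ω, F (ω n) ∂chainLaw f x = expect (iter f n x) F := by
  induction n generalizing F with
  | zero => simp [lintegral_chainLaw_zero, iter]
  | succ n ih => 
    rw [lintegral_chainLaw_succ, ih (fun y => expect (f y) F), iter_succ', expect_bind]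

/-- Transfers almost sure statements about one coordinate to the support of a `PMF`, so that the
estimates below need no trajectories. -/
theorem ae_chainLaw_iff {f : X → PMF X} {x : X} {n : ℕ} {p : X → Prop} :
    (∀ᵐ ω ∂chainLaw f x, p (ω n)) ↔ ∀ y, iter f n x y ≠ 0 → p y := by
  classical
  have h := lintegral_chainLaw f x n (fun y => if p y then 0 else 1)
  have hm : Measurable fun ω : ℕ → X => (if p (ω n) then 0 else 1 : ℝ≥0∞) :=
    (Measurable.of_discrete (f := fun y => (if p y then 0 else 1 : ℝ≥0∞))).comp
      (measurable_pi_apply n)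
  constructor
  · intro hp y hy
    rw [lintegral_congr_ae (g := fun _ => 0)] at h
    · have := expect_eq_zero.1 (by simpa using h.symm) y hy
      simpa using this
    · filter_upwards [hp] with ω hω
      simp [hω]
  · intro hp
    rw [expect_eq_zero.2, lintegral_eq_zero_iff hm] at h
    · filter_upwards [h] with ω hω
      simpa using hω
    · intro y hy
      simp [hp y hy]

end Chain

end GoldenHandcuffs

namespace GoldenHandcuffs

variable {A O S : Type*} {R : Set ℝ}

/-! ### One step of the interaction, and shifted rewards. -/

section Step

theorem tsum_option {κ : Type*} (F : Option κ → ℝ≥0∞) : ∑' o, F o = F none + ∑' e, F (some e) := by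
  classical
  rw [ENNReal.tsum_eq_add_tsum_ite none, ← (Option.some_injective κ).tsum_eq]
  · simp
  · rintro (_ | e) ho
    · simp at ho
    · exact ⟨e, rfl⟩

theorem expect_percept (ν : Environment A O R) (h : Hist A O R) (a : A)
    (F : Option (O × R) → ℝ≥0∞) :
    expect (ν.percept h a) F =
      (1 - ∑' e, ν.prob h a e) * F none + ∑' e, ν.prob h a e * F (some e) := by
  rw [expect, tsum_option]
  rfl

/-- The node reached when the action `a` and the outcome `o` follow the history `h`. -/
def Node.next (h : Hist A O R) (a : A) (s : S) (o : Option (O × R)) : Node A O R S :=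
  o.elim .ended fun e => .running ((a, e) :: h) s

theorem expect_step_running (ν : Environment A O R) (ag : Agent A O R S) (h : Hist A O R) (s : S)
    (F : Node A O R S → ℝ≥0∞) :
    expect (step ν ag (.running h s)) F =
      expect (ag h s) fun as => expect (ν.percept h as.1) fun o => F (.next h as.1 as.2 o) := by
  simp only [step, expect_bind, expect_map]
  rfl

theorem expect_step_toAgent (ν : Environment A O R) (π : Policy A O R) (h : Hist A O R)
    (F : Node A O R Unit → ℝ≥0∞) :
    expect (step ν π.toAgent (.running h ())) F =
      expect (π h) fun a => expect (ν.percept h a) fun o => F (.next h a () o) := by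
  rw [expect_step_running, Policy.toAgent, expect_map]

theorem iter_step_ended (ν : Environment A O R) (ag : Agent A O R S) (n : ℕ) :
    iter (step ν ag) n .ended = PMF.pure .ended := by
  induction n with
  | zero => rfl
  | succ n ih => simp [iter, step, ih]

/-- Forget the internal state of the agent. -/
def Node.forget : Node A O R S → Node A O R Unit
  | .ended => .ended
  | .running h _ => .running h ()

@[simp] theorem Node.forget_next (h : Hist A O R) (a : A) (s : S) (o : Option (O × R)) :
    (Node.next h a s o).forget = .next h a () o := by
  cases o <;> rfl

@[simp] theorem Node.reward_forget (x : Node A O R S) : x.forget.reward = x.reward := by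
  rcases x with _ | ⟨_ | ⟨_, _⟩, _⟩ <;> rfl

theorem reward_mem {L : ℝ} (hL : 0 ≤ L) (hR : R ⊆ Set.Icc (-L) 1) (x : Node A O R S) :
    x.reward ∈ Set.Icc (-L) 1 := by
  rcases x with _ | ⟨_ | ⟨⟨_, _, r⟩, _⟩, _⟩
  · simp [Node.reward, hL]
  · simp [Node.reward, hL]
  · exact hR r.2

/-- The most recent reward, shifted by `L`. -/
noncomputable def shiftedReward (L : ℝ) (x : Node A O R S) : ℝ≥0∞ := ENNReal.ofReal (x.reward + L)

theorem shiftedReward_le {L : ℝ} (hL : 0 ≤ L) (hR : R ⊆ Set.Icc (-L) 1) (x : Node A O R S) :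
    shiftedReward L x ≤ ENNReal.ofReal (L + 1) :=
  ENNReal.ofReal_le_ofReal (by linarith [(reward_mem hL hR x).2])

@[simp] theorem shiftedReward_forget (L : ℝ) (x : Node A O R S) :
    shiftedReward L x.forget = shiftedReward L x := by
  simp [shiftedReward]

end Step

/-! ### Shifted values and the Bellman equation. -/

section Discount

theorem ofReal_one_sub_add {γ : ℝ} (hγ₀ : 0 < γ) (hγ₁ : γ < 1) :
    ENNReal.ofReal (1 - γ) + ENNReal.ofReal γ = 1 := by
  rw [← ENNReal.ofReal_add (by linarith) hγ₀.le]
  simp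

theorem one_sub_ofReal {γ : ℝ} (hγ₀ : 0 < γ) : 1 - ENNReal.ofReal γ = ENNReal.ofReal (1 - γ) := by
  rw [ENNReal.ofReal_sub _ hγ₀.le, ENNReal.ofReal_one]

theorem tsum_discount {γ : ℝ} (hγ₀ : 0 < γ) (hγ₁ : γ < 1) :
    ∑' k : ℕ, ENNReal.ofReal (1 - γ) * ENNReal.ofReal γ ^ k = 1 := by
  rw [ENNReal.tsum_mul_left, ENNReal.tsum_geometric, one_sub_ofReal hγ₀]
  exact ENNReal.mul_inv_cancel (by simpa using hγ₁) ENNReal.ofReal_ne_top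

/-- The expected discounted sum of `1 - γ` times the future rewards, each of them shifted by `L`. -/
noncomputable def shiftedValue (γ L : ℝ) (ν : Environment A O R) (ag : Agent A O R S)
    (x : Node A O R S) : ℝ≥0∞ :=
  ∑' k : ℕ, ENNReal.ofReal (1 - γ) * ENNReal.ofReal γ ^ k *
    expect (iter (step ν ag) (k + 1) x) (shiftedReward L)

theorem shiftedValue_le {γ L : ℝ} (hγ₀ : 0 < γ) (hγ₁ : γ < 1) (hL : 0 ≤ L)
    (hR : R ⊆ Set.Icc (-L) 1) (ν : Environment A O R) (ag : Agent A O R S) (x : Node A O R S) :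
    shiftedValue γ L ν ag x ≤ ENNReal.ofReal (L + 1) := by
  calc shiftedValue γ L ν ag x
      ≤ ∑' k : ℕ, ENNReal.ofReal (1 - γ) * ENNReal.ofReal γ ^ k * ENNReal.ofReal (L + 1) := by
        refine ENNReal.tsum_le_tsum fun k => ?_
        gcongr
        exact expect_le_const (shiftedReward_le hL hR)
    _ = ENNReal.ofReal (L + 1) := by rw [ENNReal.tsum_mul_right, tsum_discount hγ₀ hγ₁, one_mul]

theorem shiftedValue_ne_top {γ L : ℝ} (hγ₀ : 0 < γ) (hγ₁ : γ < 1) (hL : 0 ≤ L)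
    (hR : R ⊆ Set.Icc (-L) 1) (ν : Environment A O R) (ag : Agent A O R S) (x : Node A O R S) :
    shiftedValue γ L ν ag x ≠ ⊤ :=
  ((shiftedValue_le hγ₀ hγ₁ hL hR ν ag x).trans_lt ENNReal.ofReal_lt_top).ne

/-- The Bellman equation. -/
theorem shiftedValue_eq (γ L : ℝ) (ν : Environment A O R) (ag : Agent A O R S)
    (x : Node A O R S) :
    shiftedValue γ L ν ag x = expect (step ν ag x) fun y =>
      ENNReal.ofReal (1 - γ) * shiftedReward L y + ENNReal.ofReal γ * shiftedValue γ L ν ag y := by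
  have e (k : ℕ) : expect (iter (step ν ag) (k + 1 + 1) x) (shiftedReward L) =
      expect (step ν ag x) fun y => expect (iter (step ν ag) (k + 1) y) (shiftedReward L) := by
    rw [iter, expect_bind]
  rw [expect_add, expect_const_mul, expect_const_mul]
  unfold shiftedValue
  rw [tsum_eq_zero_add' ENNReal.summable, expect_tsum, pow_zero, mul_one, iter_one,
    ← ENNReal.tsum_mul_left]
  congr 1
  refine tsum_congr fun k => ?_
  rw [e, expect_const_mul]
  ring

/-- The discount weights sum to 1, so shifting every reward by `L` shifts the value by `L`. This
includes the rewards missing after the end, which count as 0 and hence as `L` after the shift. -/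
theorem value_eq {γ L : ℝ} (hγ₀ : 0 < γ) (hγ₁ : γ < 1) (hL : 0 ≤ L)
    (hR : R ⊆ Set.Icc (-L) 1) (ν : Environment A O R) (ag : Agent A O R S) (h : Hist A O R)
    (s : S) : value γ ν ag h s = (shiftedValue γ L ν ag (.running h s)).toReal - L := by
  have hr (x : Node A O R S) := reward_mem hL hR x
  have hgeo : Summable fun k : ℕ => (1 - γ) * γ ^ k :=
    (summable_geometric_of_lt_one hγ₀.le hγ₁).mul_left _
  have hgeo1 : ∑' k : ℕ, (1 - γ) * γ ^ k = 1 := by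
    rw [tsum_mul_left, tsum_geometric_of_lt_one hγ₀.le hγ₁]
    exact mul_inv_cancel₀ (by linarith)
  set G : (ℕ → Node A O R S) → ℝ≥0∞ := fun ω => ∑' k : ℕ,
    ENNReal.ofReal (1 - γ) * ENNReal.ofReal γ ^ k * shiftedReward L (ω (k + 1)) with hG
  have hmeas (k : ℕ) : Measurable fun ω : ℕ → Node A O R S =>
      ENNReal.ofReal (1 - γ) * ENNReal.ofReal γ ^ k * shiftedReward L (ω (k + 1)) :=
    (Measurable.of_discrete (f := fun y : Node A O R S =>
      ENNReal.ofReal (1 - γ) * ENNReal.ofReal γ ^ k * shiftedReward L y)).comp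
      (measurable_pi_apply (k + 1))
  have hGle (ω) : G ω ≤ ENNReal.ofReal (L + 1) := by
    calc G ω ≤ ∑' k : ℕ, ENNReal.ofReal (1 - γ) * ENNReal.ofReal γ ^ k * ENNReal.ofReal (L + 1) := by
          refine ENNReal.tsum_le_tsum fun k => ?_
          gcongr
          exact shiftedReward_le hL hR _
      _ = ENNReal.ofReal (L + 1) := by rw [ENNReal.tsum_mul_right, tsum_discount hγ₀ hγ₁, one_mul]
  have hGtop (ω) : G ω < ⊤ := (hGle ω).trans_lt ENNReal.ofReal_lt_top
  have hGm : Measurable G := Measurable.tsum hmeas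
  have key (ω : ℕ → Node A O R S) :
      (1 - γ) * ∑' k : ℕ, γ ^ k * (ω (k + 1)).reward = (G ω).toReal - L := by
    have hs : Summable fun k : ℕ => (1 - γ) * γ ^ k * ((ω (k + 1)).reward + L) := by
      refine Summable.of_nonneg_of_le (fun k => ?_) (fun k => ?_) (hgeo.mul_right (1 + L))
      · have := (hr (ω (k + 1))).1
        have : 0 ≤ (1 - γ) * γ ^ k := mul_nonneg (by linarith) (by positivity)
        exact mul_nonneg this (by linarith)
      · have := (hr (ω (k + 1))).2
        have : 0 ≤ (1 - γ) * γ ^ k := mul_nonneg (by linarith) (by positivity)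
        gcongr
    have h0 (k : ℕ) : 0 ≤ (1 - γ) * γ ^ k * ((ω (k + 1)).reward + L) := by
      have := (hr (ω (k + 1))).1
      have : 0 ≤ (1 - γ) * γ ^ k := mul_nonneg (by linarith) (by positivity)
      exact mul_nonneg this (by linarith)
    have h1 : G ω = ENNReal.ofReal (∑' k : ℕ, (1 - γ) * γ ^ k * ((ω (k + 1)).reward + L)) := by
      rw [ENNReal.ofReal_tsum_of_nonneg h0 hs]
      refine tsum_congr fun k => ?_
      rw [ENNReal.ofReal_mul (mul_nonneg (by linarith) (by positivity)),
        ENNReal.ofReal_mul (by linarith), ENNReal.ofReal_pow hγ₀.le]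
      rfl
    have hconst : Summable fun k : ℕ => (1 - γ) * γ ^ k * L := hgeo.mul_right L
    rw [h1, ENNReal.toReal_ofReal (tsum_nonneg h0), ← tsum_mul_left, eq_sub_iff_add_eq]
    have h2 : L = ∑' k : ℕ, (1 - γ) * γ ^ k * L := by rw [tsum_mul_right, hgeo1, one_mul]
    conv_lhs => rw [h2]
    rw [← Summable.tsum_add _ hconst]
    · refine tsum_congr fun k => ?_
      ring
    · refine (hs.sub hconst).congr fun k => ?_
      ring
  unfold value
  simp_rw [key]
  rw [integral_sub, integral_toReal hGm.aemeasurable (ae_of_all _ hGtop)]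
  · have : IsProbabilityMeasure (law ν ag h s) := by unfold law; infer_instance
    simp only [integral_const, probReal_univ, smul_eq_mul, one_mul]
    congr 2
    rw [hG, lintegral_tsum fun k => (hmeas k).aemeasurable]
    refine tsum_congr fun k => ?_
    rw [← expect_const_mul, ← lintegral_chainLaw]
    rfl
  · have : IsProbabilityMeasure (law ν ag h s) := by unfold law; infer_instance
    refine Integrable.of_bound (C := L + 1) hGm.ennreal_toReal.aestronglyMeasurable
      (ae_of_all _ fun ω => ?_)
    rw [Real.norm_of_nonneg ENNReal.toReal_nonneg]
    exact ENNReal.toReal_le_of_le_ofReal (by linarith) (hGle ω)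
  · have : IsProbabilityMeasure (law ν ag h s) := by unfold law; infer_instance
    exact integrable_const _

end Discount

/-! ### Optimality against agents with internal state. -/

section Optimality

variable {γ L : ℝ} (hγ₀ : 0 < γ) (hγ₁ : γ < 1) (hL : 0 ≤ L) (hR : R ⊆ Set.Icc (-L) 1)
  {ξ : Environment A O R} {πopt : Policy A O R} (hopt : IsBayesOptimal γ ξ πopt)

include hγ₀ hγ₁ hL hR

theorem optValue_eq (hopt : IsBayesOptimal γ ξ πopt) (h : Hist A O R) :
    optValue γ ξ h = (shiftedValue γ L ξ πopt.toAgent (.running h ())).toReal - L := by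
  rw [← value_eq hγ₀ hγ₁ hL hR]
  have : Nonempty (Policy A O R) := ⟨πopt⟩
  refine le_antisymm (ciSup_le fun π => hopt h π) ?_
  exact le_ciSup (f := fun π : Policy A O R => policyValue γ ξ π h)
    ⟨policyValue γ ξ πopt h, by rintro _ ⟨π, rfl⟩; exact hopt h π⟩ πopt

include hopt

theorem shiftedValue_policy_le (π : Policy A O R) (h : Hist A O R) :
    shiftedValue γ L ξ π.toAgent (.running h ()) ≤
      shiftedValue γ L ξ πopt.toAgent (.running h ()) := by
  have := hopt h π
  rw [policyValue, policyValue, value_eq hγ₀ hγ₁ hL hR, value_eq hγ₀ hγ₁ hL hR,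
    sub_le_sub_iff_right] at this
  exact (ENNReal.toReal_le_toReal (shiftedValue_ne_top hγ₀ hγ₁ hL hR _ _ _)
    (shiftedValue_ne_top hγ₀ hγ₁ hL hR _ _ _)).1 this

/-- One-step deviation: compare `πopt` with the policy that plays `a` at `h` and agrees with `πopt`
elsewhere. Histories only grow, so `h` never recurs and the continuation values coincide. -/
theorem expect_percept_le_shiftedValue (h : Hist A O R) (a : A) :
    (expect (ξ.percept h a) fun o => ENNReal.ofReal (1 - γ) * shiftedReward L (.next h a () o) +
      ENNReal.ofReal γ * shiftedValue γ L ξ πopt.toAgent (.next h a () o)) ≤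
      shiftedValue γ L ξ πopt.toAgent (.running h ()) := by
  classical
  let π : Policy A O R := Function.update πopt h (PMF.pure a)
  have agree (n : ℕ) : ∀ h' : Hist A O R, h.length < h'.length →
      iter (step ξ π.toAgent) n (.running h' ()) =
        iter (step ξ πopt.toAgent) n (.running h' ()) := by
    induction n with
    | zero => intros; rfl
    | succ n ih =>
      intro h' hh'
      have hne : h' ≠ h := by rintro rfl; exact lt_irrefl _ hh'
      have hπ : π h' = πopt h' := Function.update_of_ne hne _ _
      simp only [iter, step, Policy.toAgent, PMF.bind_bind, hπ, PMF.bind_map]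
      congr 1
      funext a'
      simp only [Function.comp_apply, PMF.bind_map]
      congr 1
      funext o
      rcases o with _ | e
      · simp [iter_step_ended]
      · exact ih ((a', e) :: h') (by simp only [List.length_cons]; omega)
  have hQ (o : Option (O × R)) : shiftedValue γ L ξ π.toAgent (.next h a () o) =
      shiftedValue γ L ξ πopt.toAgent (.next h a () o) := by
    rcases o with _ | e
    · simp only [shiftedValue, Node.next, Option.elim, iter_step_ended]
    · simp only [shiftedValue, Node.next, Option.elim]
      refine tsum_congr fun k => ?_
      rw [agree _ _ (by simp)]
  refine le_trans (le_of_eq ?_) (shiftedValue_policy_le hγ₀ hγ₁ hL hR hopt π h)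
  rw [shiftedValue_eq, expect_step_toAgent]
  have : π h = PMF.pure a := Function.update_self ..
  rw [this, expect_pure]
  simp only [hQ]

/-- No agent, with or without internal state, is better than the optimal policy. -/
theorem shiftedValue_le_opt (ag : Agent A O R S) (x : Node A O R S) :
    shiftedValue γ L ξ ag x ≤ shiftedValue γ L ξ πopt.toAgent x.forget := by
  -- Induction on a truncated horizon; as shifted rewards are nonnegative, the value is the supremum
  -- of the truncated sums.
  have key (n : ℕ) : ∀ x : Node A O R S,
      ∑ k ∈ Finset.range n, ENNReal.ofReal (1 - γ) * ENNReal.ofReal γ ^ k *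
        expect (iter (step ξ ag) (k + 1) x) (shiftedReward L) ≤
      shiftedValue γ L ξ πopt.toAgent x.forget := by
    induction n with
    | zero => simp
    | succ n ih =>
      intro x
      rcases x with _ | ⟨h, s⟩
      · refine le_trans (le_of_eq ?_) (ENNReal.sum_le_tsum (Finset.range (n + 1)))
        simp only [Node.forget, iter_step_ended, expect_pure]
        rfl
      have e : ∑ k ∈ Finset.range (n + 1), ENNReal.ofReal (1 - γ) * ENNReal.ofReal γ ^ k *
          expect (iter (step ξ ag) (k + 1) (.running h s)) (shiftedReward L) =
          expect (step ξ ag (.running h s)) fun y => ENNReal.ofReal (1 - γ) * shiftedReward L y +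
            ENNReal.ofReal γ * ∑ k ∈ Finset.range n, ENNReal.ofReal (1 - γ) *
              ENNReal.ofReal γ ^ k * expect (iter (step ξ ag) (k + 1) y) (shiftedReward L) := by
        rw [Finset.sum_range_succ', expect_add, expect_const_mul, expect_const_mul,
          expect_finset_sum, add_comm, pow_zero, mul_one, iter_one, Finset.mul_sum]
        congr 1
        refine Finset.sum_congr rfl fun k _ => ?_
        rw [expect_const_mul, iter, expect_bind]
        ring
      rw [e, expect_step_running]
      refine expect_le_const fun as => ?_
      refine le_trans (expect_mono fun o => ?_)
        (expect_percept_le_shiftedValue hγ₀ hγ₁ hL hR hopt h as.1)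
      have := ih (.next h as.1 as.2 o)
      rw [Node.forget_next] at this
      rw [← shiftedReward_forget, Node.forget_next]
      gcongr
  rw [shiftedValue, ENNReal.tsum_eq_iSup_nat]
  exact iSup_le fun n => key n x

end Optimality

end GoldenHandcuffs

namespace GoldenHandcuffs

variable {A O S N : Type*} {R : Set ℝ}

/-! ### Histories possible under an environment. -/

section Support

namespace Environment

theorem causal_le_one (ν : Environment A O R) : ∀ h, ν.causal h ≤ 1
  | [] => le_rfl
  | (a, e) :: h => mul_le_one' (ν.causal_le_one h)
      ((ENNReal.le_tsum e).trans (ν.tsum_le_one h a))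

end Environment

/-- The environment `ν` gives positive probability to the percepts of the history. -/
def Possible (ν : Environment A O R) : Node A O R S → Prop
  | .ended => True
  | .running h _ => ν.causal h ≠ 0

theorem possible_next {ν : Environment A O R} {h : Hist A O R} (hx : ν.causal h ≠ 0) (a : A)
    (s : S) {o : Option (O × R)} (ho : ν.percept h a o ≠ 0) : Possible ν (.next h a s o) := by
  rcases o with _ | e
  · trivial
  · exact mul_ne_zero hx ho

theorem possible_step {ν : Environment A O R} {ag : Agent A O R S} {x y : Node A O R S}
    (hx : Possible ν x) (hy : step ν ag x y ≠ 0) : Possible ν y := by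
  rcases x with _ | ⟨h, s⟩
  · rw [← PMF.mem_support_iff, step, PMF.mem_support_pure_iff] at hy
    rw [hy]
    trivial
  · simp only [step, ← PMF.mem_support_iff, PMF.mem_support_bind_iff, PMF.mem_support_map_iff] at hy
    obtain ⟨as, _, o, ho, rfl⟩ := hy
    exact possible_next hx as.1 as.2 ho

theorem possible_iter {ν : Environment A O R} {ag : Agent A O R S} {n : ℕ} {x y : Node A O R S}
    (hx : Possible ν x) (hy : iter (step ν ag) n x y ≠ 0) : Possible ν y := by
  induction n generalizing x with
  | zero =>
    rw [← PMF.mem_support_iff, iter, PMF.mem_support_pure_iff] at hy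
    rwa [hy]
  | succ n ih =>
    rw [iter, ← PMF.mem_support_iff, PMF.mem_support_bind_iff] at hy
    obtain ⟨z, hz, hy⟩ := hy
    exact ih (possible_step hx hz) hy

end Support

/-! ### The function z - 1 - log z. -/

section LogInequality

/-- The first two terms of the series of -log(1 - x) at x = 1 - z; the remaining terms are
nonnegative. -/
theorem sq_one_sub_le {z : ℝ} (hz : 0 < z) (hz1 : z ≤ 1) :
    (1 - z) ^ 2 ≤ 2 * (z - 1 - Real.log z) := by
  have h := Real.hasSum_pow_div_log_of_abs_lt_one (x := 1 - z)
    (by rw [abs_of_nonneg (by linarith)]; linarith)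
  have h2 := sum_le_hasSum (Finset.range 2)
    (fun i _ => div_nonneg (pow_nonneg (by linarith : 0 ≤ 1 - z) _) (by positivity)) h
  norm_num [Finset.sum_range_succ] at h2
  linarith

/-- The function `z - 1 - log z`. -/
noncomputable def bregman (z : ℝ≥0∞) : ℝ≥0∞ := ENNReal.ofReal (z.toReal - 1 - Real.log z.toReal)

theorem one_sub_sq_le_bregman {z : ℝ≥0∞} (hz : z ≠ 0) (hz' : z ≠ ⊤) :
    (1 - z) ^ 2 ≤ 2 * bregman z := by
  rcases le_total 1 z with h | h
  · simp [tsub_eq_zero_of_le h]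
  · have h0 : 0 < z.toReal := ENNReal.toReal_pos hz hz'
    have h1 : z.toReal ≤ 1 := ENNReal.toReal_le_of_le_ofReal zero_le_one (by simpa using h)
    have e : 1 - z = ENNReal.ofReal (1 - z.toReal) := by
      rw [ENNReal.ofReal_sub _ h0.le, ENNReal.ofReal_toReal hz', ENNReal.ofReal_one]
    have e2 : (2 : ℝ≥0∞) = ENNReal.ofReal 2 := by simp
    rw [e, bregman, e2, ← ENNReal.ofReal_pow (by linarith), ← ENNReal.ofReal_mul (by norm_num)]
    exact ENNReal.ofReal_le_ofReal (sq_one_sub_le h0 h1)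

end LogInequality

/-! ### Likelihood ratio, change of measure and information gain. -/

section Mixture

variable (M : N → Environment A O R) (w : N → ℝ≥0) (m : N)

/-- The ratio of the causal probabilities of a history under the mixture and under the model `m`. -/
noncomputable def ratio : Node A O R S → ℝ≥0∞
  | .ended => 1
  | .running h _ => mixCausal M w h / (M m).causal h

/-- The log-likelihood ratio of the mixture to the model `m`, shifted to be nonnegative. -/
noncomputable def potential (x : Node A O R S) : ℝ≥0∞ :=
  ENNReal.ofReal (Real.log (ratio M w m x).toReal + Real.log (1 / (w m : ℝ)))

/-- A divergence of the mixture from the model `m`, for the next `k` time steps. -/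
noncomputable def divergence (ag : Agent A O R S) (k : ℕ) (x : Node A O R S) : ℝ≥0∞ :=
  expect (iter (step (M m) ag) k x) fun y => bregman (ratio M w m y / ratio M w m x)

/-- A bound for the total variation distance of the mixture from the model `m`, for the next `k`
time steps. -/
noncomputable def deficit (ag : Agent A O R S) (k : ℕ) (x : Node A O R S) : ℝ≥0∞ :=
  expect (iter (step (M m) ag) k x) fun y => 1 - ratio M w m y / ratio M w m x

/-- The expected decrease of the log-likelihood ratio in the next `k` time steps. -/
noncomputable def infoGain (ag : Agent A O R S) (k : ℕ) (x : Node A O R S) : ℝ≥0∞ :=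
  potential M w m x - expect (iter (step (M m) ag) k x) (potential M w m)

variable {M w m}

@[simp] theorem ratio_forget (x : Node A O R S) : ratio M w m x.forget = ratio M w m x := by
  cases x <;> rfl

theorem mixCausal_le_one (hw₁ : ∑' n, (w n : ℝ≥0∞) ≤ 1) : ∀ h : Hist A O R, mixCausal M w h ≤ 1
  | [] => le_rfl
  | x :: h => by
    refine le_trans (ENNReal.tsum_le_tsum fun n => ?_) hw₁
    exact mul_le_of_le_one_right' ((M n).causal_le_one _)

theorem weight_mul_causal_le (hw₁ : ∑' n, (w n : ℝ≥0∞) ≤ 1) (h : Hist A O R) :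
    (w m : ℝ≥0∞) * (M m).causal h ≤ mixCausal M w h := by
  cases h with
  | nil => simpa [mixCausal, Environment.causal] using (ENNReal.le_tsum m).trans hw₁
  | cons x h => exact ENNReal.le_tsum (f := fun n => (w n : ℝ≥0∞) * (M n).causal (x :: h)) m

section

variable (hw : 0 < w m) (hw₁ : ∑' n, (w n : ℝ≥0∞) ≤ 1)
include hw₁

theorem weight_le_one : (w m : ℝ) ≤ 1 := by
  have h : (w m : ℝ≥0∞) ≤ 1 := (ENNReal.le_tsum m).trans hw₁
  exact_mod_cast h

/-- The mixture dominates each weighted model. This lower bound is what makes the logarithm in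
`potential` nonnegative; the convention that the ratio is 1 at the ended node respects it, as
weights are at most 1. -/
theorem weight_le_ratio {x : Node A O R S} (hx : Possible (M m) x) :
    (w m : ℝ≥0∞) ≤ ratio M w m x := by
  rcases x with _ | ⟨h, s⟩
  · exact (ENNReal.le_tsum m).trans hw₁
  · rw [ratio, ENNReal.le_div_iff_mul_le (Or.inl hx)
      (Or.inl (((M m).causal_le_one h).trans_lt ENNReal.one_lt_top).ne)]
    exact weight_mul_causal_le hw₁ h

theorem ratio_ne_top {x : Node A O R S} (hx : Possible (M m) x) : ratio M w m x ≠ ⊤ := by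
  rcases x with _ | ⟨h, s⟩
  · exact ENNReal.one_ne_top
  · exact ENNReal.div_ne_top ((mixCausal_le_one hw₁ h).trans_lt ENNReal.one_lt_top).ne hx

include hw

theorem ratio_ne_zero {x : Node A O R S} (hx : Possible (M m) x) : ratio M w m x ≠ 0 := by
  have h : (0 : ℝ≥0∞) < w m := by exact_mod_cast hw
  exact (h.trans_le (weight_le_ratio hw₁ hx)).ne'

variable (hμ₁ : (M m).IsProper)
include hμ₁

/-- The likelihood ratio as a density: one percept multiplies it by the quotient of conditional
probabilities. Only an inequality holds, because the mixture may also end the interaction or emit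
percepts that are impossible under the model, whereas the proper model never ends. -/
theorem expect_step_ratio_le (ag : Agent A O R S) {x : Node A O R S} (hx : Possible (M m) x)
    (F : Node A O R S → ℝ≥0∞) :
    (expect (step (M m) ag x) fun y => ratio M w m y * F y) ≤
      ratio M w m x * expect (step (mixture M w hw₁) ag x) F := by
  rcases x with _ | ⟨h, s⟩
  · simp [step]
  rw [expect_step_running, expect_step_running, ← expect_const_mul]
  refine expect_mono fun as => ?_
  rw [expect_percept, expect_percept, hμ₁ h as.1, tsub_self, zero_mul, zero_add, mul_add]
  refine le_add_left ?_
  rw [← ENNReal.tsum_mul_left]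
  refine ENNReal.tsum_le_tsum fun e => ?_
  rw [← mul_assoc, ← mul_assoc]
  refine mul_le_mul_left ?_ _
  have hm0 : mixCausal M w h ≠ 0 := by
    have := ratio_ne_zero hw hw₁ (x := .running h s) hx
    rw [ratio, ne_eq, ENNReal.div_eq_zero_iff, not_or] at this
    exact this.1
  have hm1 : mixCausal M w h ≠ ⊤ := ((mixCausal_le_one hw₁ h).trans_lt ENNReal.one_lt_top).ne
  have hc1 : (M m).causal h ≠ ⊤ := (((M m).causal_le_one h).trans_lt ENNReal.one_lt_top).ne
  change (M m).prob h as.1 e * (mixCausal M w ((as.1, e) :: h) /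
      ((M m).causal h * (M m).prob h as.1 e)) ≤
    mixCausal M w h / (M m).causal h * (mixCausal M w ((as.1, e) :: h) / mixCausal M w h)
  by_cases hp : (M m).prob h as.1 e = 0
  · simp [hp]
  have hp1 : (M m).prob h as.1 e ≠ ⊤ :=
    (((ENNReal.le_tsum e).trans ((M m).tsum_le_one h as.1)).trans_lt ENNReal.one_lt_top).ne
  rw [div_eq_mul_inv, ENNReal.mul_inv (Or.inl hx) (Or.inl hc1), div_eq_mul_inv, div_eq_mul_inv]
  have e1 := ENNReal.mul_inv_cancel hp hp1
  have e2 := ENNReal.mul_inv_cancel hm0 hm1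
  refine le_of_eq ?_
  calc _ = mixCausal M w ((as.1, e) :: h) * ((M m).causal h)⁻¹ *
        ((M m).prob h as.1 e * ((M m).prob h as.1 e)⁻¹) := by ring
    _ = mixCausal M w ((as.1, e) :: h) * ((M m).causal h)⁻¹ *
        (mixCausal M w h * (mixCausal M w h)⁻¹) := by rw [e1, e2]
    _ = _ := by ring

theorem expect_iter_ratio_le (ag : Agent A O R S) (n : ℕ) {x : Node A O R S}
    (hx : Possible (M m) x) (F : Node A O R S → ℝ≥0∞) :
    (expect (iter (step (M m) ag) n x) fun y => ratio M w m y * F y) ≤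
      ratio M w m x * expect (iter (step (mixture M w hw₁) ag) n x) F := by
  induction n generalizing x with
  | zero => simp [iter]
  | succ n ih =>
    rw [iter, iter, expect_bind, expect_bind]
    exact (expect_mono_support fun y hy => ih (possible_step hx hy)).trans
      (expect_step_ratio_le hw hw₁ hμ₁ ag hx _)

/-- Change of measure. -/
theorem expect_iter_ratio_div_le (ag : Agent A O R S) (n : ℕ) {x : Node A O R S}
    (hx : Possible (M m) x) (F : Node A O R S → ℝ≥0∞) :
    (expect (iter (step (M m) ag) n x) fun y => ratio M w m y / ratio M w m x * F y) ≤
      expect (iter (step (mixture M w hw₁) ag) n x) F := by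
  have e (y : Node A O R S) : ratio M w m y / ratio M w m x * F y =
      (ratio M w m x)⁻¹ * (ratio M w m y * F y) := by rw [div_eq_mul_inv]; ring
  simp_rw [e]
  rw [expect_const_mul]
  calc _ ≤ (ratio M w m x)⁻¹ * (ratio M w m x *
        expect (iter (step (mixture M w hw₁) ag) n x) F) := by
        gcongr
        exact expect_iter_ratio_le hw hw₁ hμ₁ ag n hx F
    _ = _ := by
      rw [← mul_assoc, ENNReal.inv_mul_cancel (ratio_ne_zero hw hw₁ hx) (ratio_ne_top hw₁ hx),
        one_mul]

theorem expect_iter_ratio_div_le_one (ag : Agent A O R S) (n : ℕ) {x : Node A O R S}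
    (hx : Possible (M m) x) :
    (expect (iter (step (M m) ag) n x) fun y => ratio M w m y / ratio M w m x) ≤ 1 := by
  simpa using expect_iter_ratio_div_le hw hw₁ hμ₁ ag n hx fun _ => 1

-- The logarithm of a quotient of ratios is a difference of potentials. All terms are moved to the
-- side where they are added, which avoids truncated subtraction.
omit hμ₁ in
theorem bregman_add_potential {x y : Node A O R S} (hx : Possible (M m) x)
    (hy : Possible (M m) y) :
    bregman (ratio M w m y / ratio M w m x) + potential M w m y + 1 =
      ratio M w m y / ratio M w m x + potential M w m x := by
  have hx0 := ENNReal.toReal_pos (ratio_ne_zero hw hw₁ hx) (ratio_ne_top hw₁ hx)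
  have hy0 := ENNReal.toReal_pos (ratio_ne_zero hw hw₁ hy) (ratio_ne_top hw₁ hy)
  have hpot (v : Node A O R S) (hv : Possible (M m) v) :
      0 ≤ Real.log (ratio M w m v).toReal + Real.log (1 / (w m : ℝ)) := by
    have h1 : (w m : ℝ) ≤ (ratio M w m v).toReal := by
      simpa using ENNReal.toReal_mono (ratio_ne_top hw₁ hv) (weight_le_ratio hw₁ hv)
    have h2 := Real.log_le_log (by exact_mod_cast hw) h1
    rw [one_div, Real.log_inv]
    linarith
  have hz : ratio M w m y / ratio M w m x =
      ENNReal.ofReal ((ratio M w m y).toReal / (ratio M w m x).toReal) := by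
    rw [ENNReal.ofReal_div_of_pos hx0, ENNReal.ofReal_toReal (ratio_ne_top hw₁ hy),
      ENNReal.ofReal_toReal (ratio_ne_top hw₁ hx)]
  have hz0 : 0 < (ratio M w m y).toReal / (ratio M w m x).toReal := by positivity
  have hb := Real.log_le_sub_one_of_pos hz0
  rw [bregman, hz, ENNReal.toReal_ofReal hz0.le, potential, potential, ← ENNReal.ofReal_one,
    ← ENNReal.ofReal_add (by linarith) (hpot y hy), ← ENNReal.ofReal_add _ zero_le_one,
    ← ENNReal.ofReal_add hz0.le (hpot x hx), Real.log_div hy0.ne' hx0.ne']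
  · congr 1
    ring
  · have := hpot y hy
    linarith

omit hμ₁ in
theorem divergence_add_potential (ag : Agent A O R S) (k : ℕ) {x : Node A O R S}
    (hx : Possible (M m) x) :
    divergence M w m ag k x + expect (iter (step (M m) ag) k x) (potential M w m) + 1 =
      (expect (iter (step (M m) ag) k x) fun y => ratio M w m y / ratio M w m x) +
        potential M w m x := by
  have h := expect_congr_support fun y hy =>
    bregman_add_potential hw hw₁ hx (possible_iter (ag := ag) (n := k) hx hy)
  rw [expect_add, expect_add, expect_add, expect_const, expect_const] at h
  exact h

/-- The ratio has conditional mean at most 1, which cancels the constant in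
`divergence_add_potential`. -/
theorem divergence_add_potential_le (ag : Agent A O R S) (k : ℕ) {x : Node A O R S}
    (hx : Possible (M m) x) :
    divergence M w m ag k x + expect (iter (step (M m) ag) k x) (potential M w m) ≤
      potential M w m x := by
  have h := divergence_add_potential hw hw₁ ag k hx
  have h1 := expect_iter_ratio_div_le_one hw hw₁ hμ₁ ag k hx
  refine (ENNReal.add_le_add_iff_right ENNReal.one_ne_top).1 ?_
  rw [h, add_comm]
  gcongr

theorem infoGain_add_potential (ag : Agent A O R S) (k : ℕ) {x : Node A O R S}
    (hx : Possible (M m) x) :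
    infoGain M w m ag k x + expect (iter (step (M m) ag) k x) (potential M w m) =
      potential M w m x :=
  tsub_add_cancel_of_le (le_add_self.trans (divergence_add_potential_le hw hw₁ hμ₁ ag k hx))

theorem divergence_le_infoGain (ag : Agent A O R S) (k : ℕ) {x : Node A O R S}
    (hx : Possible (M m) x) : divergence M w m ag k x ≤ infoGain M w m ag k x :=
  ENNReal.le_sub_of_add_le_right
    ((le_add_self.trans (divergence_add_potential_le hw hw₁ hμ₁ ag k hx)).trans_lt
      ENNReal.ofReal_lt_top).ne
    (divergence_add_potential_le hw hw₁ hμ₁ ag k hx)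

/-- Mean ratio plus information gain equals 1 plus the divergence. The dependence on the information
gain is linear, without the square root of Pinsker; this keeps the number of safety triggers
bounded. -/
theorem one_le_expect_ratio_add_infoGain (ag : Agent A O R S) (k : ℕ) {x : Node A O R S}
    (hx : Possible (M m) x) :
    1 ≤ (expect (iter (step (M m) ag) k x) fun y => ratio M w m y / ratio M w m x) +
      infoGain M w m ag k x := by
  have h := divergence_add_potential hw hw₁ ag k hx
  rw [← infoGain_add_potential hw hw₁ hμ₁ ag k hx, ← add_assoc] at h
  refine (ENNReal.add_le_add_iff_right
    (a := expect (iter (step (M m) ag) k x) (potential M w m)) ?_).1 ?_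
  · exact ((le_add_self.trans (divergence_add_potential_le hw hw₁ hμ₁ ag k hx)).trans_lt
      ENNReal.ofReal_lt_top).ne
  · rw [← h, add_comm 1, add_assoc]
    exact le_add_self

omit hμ₁ in
/-- A form of Pinsker's inequality. -/
theorem deficit_sq_le (ag : Agent A O R S) (k : ℕ) {x : Node A O R S} (hx : Possible (M m) x) :
    deficit M w m ag k x ^ 2 ≤ 2 * divergence M w m ag k x := by
  rw [deficit, divergence, ← expect_const_mul]
  refine (expect_sq_le _ _).trans (expect_mono_support fun y hy => ?_)
  have hy' := possible_iter hx hy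
  exact one_sub_sq_le_bregman
    (ENNReal.div_ne_zero.2 ⟨ratio_ne_zero hw hw₁ hy', ratio_ne_top hw₁ hx⟩)
    (ENNReal.div_ne_top (ratio_ne_top hw₁ hy') (ratio_ne_zero hw hw₁ hx))

/-- With z the quotient of ratios, split `F` into zF and (1 - z)F: change of measure handles the
first part, and the positive part of 1 - z bounds the second. -/
theorem expect_model_le (ag : Agent A O R S) (k : ℕ) {x : Node A O R S} (hx : Possible (M m) x)
    {F : Node A O R S → ℝ≥0∞} {B : ℝ≥0∞} (hF : ∀ y, F y ≤ B) :
    expect (iter (step (M m) ag) k x) F ≤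
      expect (iter (step (mixture M w hw₁) ag) k x) F + B * deficit M w m ag k x := by
  have h (y : Node A O R S) : F y ≤ ratio M w m y / ratio M w m x * F y +
      B * (1 - ratio M w m y / ratio M w m x) := by
    set z := ratio M w m y / ratio M w m x
    calc F y = 1 * F y := (one_mul _).symm
      _ ≤ (z + (1 - z)) * F y := by
        gcongr
        exact le_add_tsub
      _ = z * F y + (1 - z) * F y := add_mul _ _ _
      _ ≤ z * F y + (1 - z) * B := by gcongr; exact hF y
      _ = _ := by rw [mul_comm B]
  refine (expect_mono h).trans ?_
  rw [expect_add, expect_const_mul]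
  exact add_le_add (expect_iter_ratio_div_le hw hw₁ hμ₁ ag k hx F) le_rfl

/-- The reverse direction follows by applying `expect_model_le` to `B - F`. -/
theorem expect_mixture_le (ag : Agent A O R S) (k : ℕ) {x : Node A O R S} (hx : Possible (M m) x)
    {F : Node A O R S → ℝ≥0∞} {B : ℝ≥0∞} (hB : B ≠ ⊤) (hF : ∀ y, F y ≤ B) :
    expect (iter (step (mixture M w hw₁) ag) k x) F ≤
      expect (iter (step (M m) ag) k x) F + B * deficit M w m ag k x := by
  have h := expect_model_le hw hw₁ hμ₁ ag k hx (F := fun y => B - F y) (B := B)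
    fun y => tsub_le_self
  have e (p : PMF (Node A O R S)) : expect p F + expect p (fun y => B - F y) = B := by
    rw [← expect_add]
    simp only [add_tsub_cancel_of_le (hF _), expect_const]
  set a := expect (iter (step (mixture M w hw₁) ag) k x) fun y => B - F y
  have ha : a ≠ ⊤ := ((expect_le_const fun y => tsub_le_self).trans_lt hB.lt_top).ne
  refine (ENNReal.add_le_add_iff_right ha).1 ?_
  calc _ = expect (iter (step (M m) ag) k x) F +
        expect (iter (step (M m) ag) k x) (fun y => B - F y) := by rw [e, e]
    _ ≤ _ := by
      rw [add_assoc, add_comm (B * _)]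
      gcongr

theorem expect_infoGain_add (ag : Agent A O R S) (t k : ℕ) {x : Node A O R S}
    (hx : Possible (M m) x) :
    expect (iter (step (M m) ag) t x) (infoGain M w m ag k) +
        expect (iter (step (M m) ag) (t + k) x) (potential M w m) =
      expect (iter (step (M m) ag) t x) (potential M w m) := by
  rw [iter_add, expect_bind, ← expect_add]
  exact expect_congr_support fun y hy =>
    infoGain_add_potential hw hw₁ hμ₁ ag k (possible_iter hx hy)

/-- The total expected information gained about the model is bounded by the log-inverse of its
prior weight. -/
theorem sum_expect_infoGain_le (ag : Agent A O R S) (s : S) (T k : ℕ) :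
    ∑ t ∈ Finset.range T, expect (iter (step (M m) ag) t (.running [] s)) (infoGain M w m ag k) ≤
      k * ENNReal.ofReal (Real.log (1 / (w m : ℝ))) := by
  have hx : Possible (M m) (.running [] s) := one_ne_zero
  set a : ℕ → ℝ≥0∞ := fun t => expect (iter (step (M m) ag) t (.running [] s)) (potential M w m)
  have ha (t : ℕ) : a t ≤ ENNReal.ofReal (Real.log (1 / (w m : ℝ))) := by
    refine le_trans (le_add_self.trans (divergence_add_potential_le hw hw₁ hμ₁ ag t hx)) ?_
    simp [potential, ratio, mixCausal, Environment.causal]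
  have hfin : ∑ t ∈ Finset.range T, a (t + k) ≠ ⊤ :=
    ENNReal.sum_ne_top.2 fun t _ => ((ha _).trans_lt ENNReal.ofReal_lt_top).ne
  refine (ENNReal.add_le_add_iff_right hfin).1 ?_
  rw [← Finset.sum_add_distrib]
  calc _ = ∑ t ∈ Finset.range T, a t :=
        Finset.sum_congr rfl fun t _ => expect_infoGain_add hw hw₁ hμ₁ ag t k hx
    -- Telescoping with lag `k`: only the first `k` expected potentials survive, each at most the
    -- initial one.
    _ ≤ ∑ t ∈ Finset.range (k + T), a t := by
        refine Finset.sum_le_sum_of_subset (Finset.range_mono (Nat.le_add_left T k))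
    _ = ∑ t ∈ Finset.range k, a t + ∑ t ∈ Finset.range T, a (t + k) := by
        rw [Finset.sum_range_add]
        simp only [add_comm k]
    _ ≤ _ := by
        gcongr
        refine (Finset.sum_le_sum fun t _ => ha t).trans ?_
        simp

end

end Mixture

end GoldenHandcuffs

namespace GoldenHandcuffs

variable {A O N ι : Type*} {R : Set ℝ}

/-! ### Branches of the agent: mentor rollouts and optimal actions. -/

section Agent

variable (γ : ℝ) (ξ ν : Environment A O R) (πopt : Policy A O R) (mentor : ι → Policy A O R)
  (v : PMF ι) (yieldTo : Hist A O R → PMF ι)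

theorem expect_coin (p : ℝ≥0) (hp : p ≤ 1) (F : Bool → ℝ≥0∞) :
    expect (coin p hp) F = p * F true + (1 - p) * F false := by
  simp [expect, coin, PMF.ofFintype_apply]

theorem expect_act_rollout (h : Hist A O R) (n : ℕ) (i : ι) (F : A × RolloutState ι → ℝ≥0∞) :
    expect (act πopt mentor h (rollout (n + 1) i)) F =
      expect (mentor i h) fun a => F (a, rollout n i) := by
  simp [rollout, act]

theorem expect_act_none (h : Hist A O R) (F : A × RolloutState ι → ℝ≥0∞) :
    expect (act πopt mentor h none) F = expect (πopt h) fun a => F (a, none) := by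
  simp [act]

theorem agentGH_some (h : Hist A O R) (x : ℕ+ × ι) :
    agentGH γ ξ πopt mentor v yieldTo h (some x) = act πopt mentor h (some x) := by
  simp [agentGH, trigger]

-- A yield gives `rollout 1`, which the action just taken uses up; hence the next state is `none`
-- there too.
open Classical in
theorem expect_agentGH_none (h : Hist A O R) (F : A × RolloutState ι → ℝ≥0∞) :
    expect (agentGH γ ξ πopt mentor v yieldTo h none) F =
      eta (h.length + 1) * (expect v fun i =>
        expect (act πopt mentor h (rollout (horizon γ (h.length + 1)) i)) F) +
      (1 - eta (h.length + 1)) *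
        (if optValue γ ξ h ≤ -1 then expect (yieldTo h) fun i => expect (mentor i h) fun a =>
            F (a, none)
          else expect (πopt h) fun a => F (a, none)) := by
  rw [agentGH, trigger, expect_bind, expect_bind, expect_coin]
  simp only [if_true, Bool.false_eq_true, if_false, expect_map]
  congr 2
  split_ifs
  · rw [expect_map]
    simp only [expect_act_rollout]
    rfl
  · rw [expect_pure, expect_act_none]

theorem expect_iter_rollout (i : ι) (G : Node A O R Unit → ℝ≥0∞) (k : ℕ) :
    ∀ (n : ℕ) (h : Hist A O R), k ≤ n →
      (expect (iter (step ν (agentGH γ ξ πopt mentor v yieldTo)) k (.running h (rollout n i)))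
        fun y => G y.forget) =
      expect (iter (step ν (mentor i).toAgent) k (.running h ())) G := by
  induction k with
  | zero => intros; simp [iter, Node.forget]
  | succ k ih =>
    intro n h hn
    obtain ⟨n, rfl⟩ : ∃ n', n = n' + 1 := ⟨n - 1, by omega⟩
    rw [iter, iter, expect_bind, expect_bind, expect_step_toAgent, expect_step_running]
    rw [rollout, agentGH_some]
    rw [← rollout, expect_act_rollout]
    congr 1
    funext a
    congr 1
    funext o
    rcases o with _ | e
    · simp [Node.next, iter_step_ended, Node.forget]
    · exact ih n _ (by omega)

/-- With probability at least η(t) times the weight of `i`, a rollout of this mentor begins now and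
covers the next `k + 1` steps. All other branches contribute nonnegatively and are dropped. -/
theorem mul_expect_mentor_le (i : ι) (G : Node A O R Unit → ℝ≥0∞) {k : ℕ} (h : Hist A O R)
    (hk : k + 1 ≤ horizon γ (h.length + 1)) :
    eta (h.length + 1) * v i *
        expect (iter (step ν (mentor i).toAgent) (k + 1) (.running h ())) G ≤
      expect (iter (step ν (agentGH γ ξ πopt mentor v yieldTo)) (k + 1) (.running h none))
        fun y => G y.forget := by
  obtain ⟨n, hn⟩ : ∃ n', horizon γ (h.length + 1) = n' + 1 := ⟨horizon γ (h.length + 1) - 1, by omega⟩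
  rw [iter, iter, expect_bind, expect_bind, expect_step_toAgent, expect_step_running,
    expect_agentGH_none]
  refine le_add_right ?_
  rw [mul_assoc]
  refine mul_le_mul_right ?_ _
  refine le_trans ?_ (mul_le_expect v _ i)
  refine mul_le_mul_right ?_ _
  rw [hn, expect_act_rollout]
  refine expect_mono fun a => expect_mono fun o => ?_
  rcases o with _ | e
  · simp [Node.next, iter_step_ended, Node.forget]
  · exact (expect_iter_rollout γ ξ ν πopt mentor v yieldTo i G k n _ (by omega)).ge

/-- Keeps the branch without exploration. The next state is again `none`, which is what allows the
estimate of `excess` to be iterated. -/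
theorem mul_expect_opt_le (G : Node A O R (RolloutState ι) → ℝ≥0∞) (h : Hist A O R)
    (hy : ¬ optValue γ ξ h ≤ -1) :
    (1 - eta (h.length + 1) : ℝ≥0∞) *
        (expect (πopt h) fun a => expect (ν.percept h a) fun o => G (.next h a none o)) ≤
      expect (step ν (agentGH γ ξ πopt mentor v yieldTo) (.running h none)) G := by
  rw [expect_step_running, expect_agentGH_none, if_neg hy]
  exact le_add_self

end Agent

/-! ### Optimal value in the mixture against the agent's true value. -/

section Excess

variable (γ L : ℝ) (M : N → Environment A O R) (w : N → ℝ≥0) (m : N)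
  (hw₁ : ∑' n, (w n : ℝ≥0∞) ≤ 1)
  (πopt : Policy A O R) (mentor : ι → Policy A O R) (v : PMF ι) (yieldTo : Hist A O R → PMF ι)

open Classical in
/-- Indicator of the event that the safety condition of the agent is triggered. -/
noncomputable def yields (ξ : Environment A O R) : Node A O R (RolloutState ι) → ℝ≥0∞
  | .ended => 0
  | .running h _ => if optValue γ ξ h ≤ -1 then 1 else 0

/-- The exploration probability. -/
noncomputable def exploreProb : Node A O R (RolloutState ι) → ℝ≥0∞
  | .ended => 0
  | .running h _ => eta (h.length + 1)

/-- How much the optimal value in the mixture exceeds the value of the agent in the model, while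
the agent is not exploring. -/
noncomputable def excess (ξ μ : Environment A O R) (GH : Agent A O R (RolloutState ι)) :
    Node A O R (RolloutState ι) → ℝ≥0∞
  | .running h none => shiftedValue γ L ξ πopt.toAgent (.running h ()) -
      shiftedValue γ L μ GH (.running h none)
  | _ => 0

/-- The expected discounted sum of the function `r` along a Markov chain. -/
noncomputable def discountedSum {X : Type*} (f : X → PMF X) (r : X → ℝ≥0∞) (x : X) : ℝ≥0∞ :=
  ∑' k : ℕ, ENNReal.ofReal γ ^ k * expect (iter f k x) r

variable {γ L M w m πopt mentor v yieldTo} (hγ₀ : 0 < γ) (hγ₁ : γ < 1) (hL : 0 ≤ L)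
  (hR : R ⊆ Set.Icc (-L) 1) (hw : 0 < w m) (hμ₁ : (M m).IsProper)
  (hopt : IsBayesOptimal γ (mixture M w hw₁) πopt)
  {GH : Agent A O R (RolloutState ι)}
  (hGH : GH = agentGH γ (mixture M w hw₁) πopt mentor v yieldTo)

include hGH

/-- This is what exploration buys: prediction errors along a mentor, weighted by the chance of a
rollout, are charged to the agent's own divergence. -/
theorem mul_divergence_mentor_le (i : ι) {k : ℕ} (h : Hist A O R)
    (hk : k + 1 ≤ horizon γ (h.length + 1)) :
    eta (h.length + 1) * v i * divergence M w m (mentor i).toAgent (k + 1) (.running h ()) ≤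
      divergence M w m GH (k + 1) (.running h none) := by
  subst hGH
  have := mul_expect_mentor_le γ (mixture M w hw₁) (M m) πopt mentor v yieldTo i
    (fun y => bregman (ratio M w m y / ratio M w m (.running h () : Node A O R Unit))) h hk
  simp only [ratio_forget] at this
  exact this

theorem mul_divergence_opt_le (h : Hist A O R) (hy : ¬ optValue γ (mixture M w hw₁) h ≤ -1) :
    (1 - eta (h.length + 1)) * divergence M w m πopt.toAgent 1 (.running h ()) ≤
      divergence M w m GH 1 (.running h none) := by
  subst hGH
  have := mul_expect_opt_le γ (mixture M w hw₁) (M m) πopt mentor v yieldTo (fun y =>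
    bregman (ratio M w m y / ratio M w m (.running h none : Node A O R (RolloutState ι)))) h hy
  rw [divergence, divergence, iter_one, iter_one, expect_step_toAgent]
  refine le_trans (le_of_eq ?_) this
  congr 1
  congr 1
  funext a
  congr 1
  funext o
  rcases o with _ | e <;> rfl

include hγ₀ hγ₁ hL hR hw hμ₁

/-- A Bellman step. Unless it explores or yields, the agent acts as `πopt` and stays in state
`none`, so the gap reappears discounted. Exploring or yielding costs at most `L + 1`, and replacing
the mixture by the model for one step costs a root of information gain. -/
theorem excess_le_step {x : Node A O R (RolloutState ι)} (hx : Possible (M m) x) :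
    excess γ L πopt (mixture M w hw₁) (M m) GH x ≤
      ENNReal.ofReal (L + 1) * (exploreProb x + yields γ (mixture M w hw₁) x +
        (2 * infoGain M w m GH 1 x) ^ (1 / 2 : ℝ)) +
      ENNReal.ofReal γ * expect (step (M m) GH x)
        (excess γ L πopt (mixture M w hw₁) (M m) GH) := by
  set ξ := mixture M w hw₁ with hξ
  set B := ENNReal.ofReal (L + 1) with hB
  rcases x with _ | ⟨h, _ | s⟩
  · simp [excess]
  swap
  · simp [excess]
  set Q := shiftedValue γ L ξ πopt.toAgent with hQ
  have hQB : Q (.running h ()) ≤ B := shiftedValue_le hγ₀ hγ₁ hL hR _ _ _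
  rw [excess, tsub_le_iff_left]
  by_cases hy : optValue γ ξ h ≤ -1
  · refine hQB.trans ?_
    calc B = B * (yields γ ξ (.running h (none : RolloutState ι))) := by
            rw [yields, if_pos hy, mul_one]
      _ ≤ _ := by
        refine le_add_left (le_add_right (mul_le_mul_right ?_ _))
        exact le_add_right le_add_self
  set η : ℝ≥0∞ := ((eta (h.length + 1) : ℝ≥0) : ℝ≥0∞) with hη
  have hη1 : η + (1 - η) = 1 :=
    add_tsub_cancel_of_le (ENNReal.coe_le_one_iff.2 (eta_le_one _))
  let F : Node A O R Unit → ℝ≥0∞ := fun y =>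
    ENNReal.ofReal (1 - γ) * shiftedReward L y + ENNReal.ofReal γ * Q y
  have hF (y) : F y ≤ B := by
    calc F y ≤ ENNReal.ofReal (1 - γ) * B + ENNReal.ofReal γ * B := by
          exact add_le_add (mul_le_mul_right (shiftedReward_le hL hR y) _)
            (mul_le_mul_right (shiftedValue_le hγ₀ hγ₁ hL hR _ _ _) _)
      _ = B := by rw [← add_mul, ofReal_one_sub_add hγ₀ hγ₁, one_mul]
  have h1 : Q (.running h ()) ≤ expect (step (M m) πopt.toAgent (.running h ())) F +
      B * deficit M w m πopt.toAgent 1 (.running h ()) := by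
    have := expect_mixture_le hw hw₁ hμ₁ πopt.toAgent 1 (x := .running h ()) hx
      ENNReal.ofReal_ne_top hF
    rw [iter_one, iter_one] at this
    rw [hQ, shiftedValue_eq]
    exact this
  -- After squaring, one factor 1 - η turns the divergence along `πopt` into that of the agent; the
  -- other is at most 1.
  have h2 : (1 - η) * deficit M w m πopt.toAgent 1 (.running h ()) ≤
      (2 * infoGain M w m GH 1 (.running h none)) ^ (1 / 2 : ℝ) := by
    rw [one_div, ENNReal.le_rpow_inv_iff (by norm_num), ENNReal.rpow_ofNat, mul_pow]
    calc (1 - η) ^ 2 * deficit M w m πopt.toAgent 1 (.running h ()) ^ 2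
        ≤ (1 - η) * (2 * divergence M w m πopt.toAgent 1 (.running h ())) := by
          refine mul_le_mul' ?_ (deficit_sq_le hw hw₁ _ _ (x := .running h ()) hx)
          rw [sq]
          exact mul_le_of_le_one_right' tsub_le_self
      _ = 2 * ((1 - η) * divergence M w m πopt.toAgent 1 (.running h ())) := by ring
      _ ≤ 2 * divergence M w m GH 1 (.running h none) := by
          refine mul_le_mul_right ?_ _
          exact mul_divergence_opt_le hw₁ hGH h hy
      _ ≤ _ := by
          refine mul_le_mul_right ?_ _
          exact divergence_le_infoGain hw hw₁ hμ₁ _ _ hx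
  have h3 : (1 - η) * expect (step (M m) πopt.toAgent (.running h ())) F ≤
      shiftedValue γ L (M m) GH (.running h none) + ENNReal.ofReal γ *
        expect (step (M m) GH (.running h none)) (excess γ L πopt ξ (M m) GH) := by
    rw [shiftedValue_eq, ← expect_const_mul (step (M m) GH (.running h none)), ← expect_add,
      expect_step_toAgent]
    have hle := mul_expect_opt_le γ ξ (M m) πopt mentor v yieldTo (fun y =>
      ENNReal.ofReal (1 - γ) * shiftedReward L y + ENNReal.ofReal γ * shiftedValue γ L (M m) GH y +
        ENNReal.ofReal γ * excess γ L πopt ξ (M m) GH y) h hy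
    rw [← hGH] at hle
    refine le_trans ?_ hle
    refine mul_le_mul_right ?_ _
    refine expect_mono fun a => expect_mono fun o => ?_
    rw [add_assoc, ← mul_add]
    refine add_le_add (le_of_eq ?_) (mul_le_mul_right ?_ _)
    · rcases o with _ | e <;> rfl
    -- At the ended node `excess` is 0, and both shifted values agree since no rewards remain.
    · rcases o with _ | e
      · refine le_add_right (le_of_eq ?_)
        simp only [hQ, shiftedValue, Node.next, Option.elim, iter_step_ended, expect_pure]
        rfl
      · exact le_add_tsub
  calc Q (.running h ()) = η * Q (.running h ()) + (1 - η) * Q (.running h ()) := by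
        rw [← add_mul, hη1, one_mul]
    _ ≤ η * B + (1 - η) * (expect (step (M m) πopt.toAgent (.running h ())) F +
          B * deficit M w m πopt.toAgent 1 (.running h ())) := by gcongr
    _ = (1 - η) * expect (step (M m) πopt.toAgent (.running h ())) F + B * (η +
          (1 - η) * deficit M w m πopt.toAgent 1 (.running h ())) := by ring
    _ ≤ (shiftedValue γ L (M m) GH (.running h none) + ENNReal.ofReal γ *
          expect (step (M m) GH (.running h none)) (excess γ L πopt ξ (M m) GH)) +
        B * (exploreProb (.running h (none : RolloutState ι)) +
          yields γ ξ (.running h (none : RolloutState ι)) +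
          (2 * infoGain M w m GH 1 (.running h none)) ^ (1 / 2 : ℝ)) := by
        refine add_le_add h3 (mul_le_mul_right (add_le_add ?_ h2) _)
        exact le_self_add
    _ = _ := by ring

/-- Unroll `excess_le_step` `n` times; the remainder is at most γ^n (L + 1) and vanishes in the
limit. -/
theorem excess_le {x : Node A O R (RolloutState ι)} (hx : Possible (M m) x) :
    excess γ L πopt (mixture M w hw₁) (M m) GH x ≤
      ENNReal.ofReal (L + 1) * discountedSum γ (step (M m) GH) (fun y =>
        exploreProb y + yields γ (mixture M w hw₁) y +
          (2 * infoGain M w m GH 1 y) ^ (1 / 2 : ℝ)) x := by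
  set ξ := mixture M w hw₁ with hξ
  set B := ENNReal.ofReal (L + 1) with hB
  set r : Node A O R (RolloutState ι) → ℝ≥0∞ := fun y => exploreProb y + yields γ ξ y +
          (2 * infoGain M w m GH 1 y) ^ (1 / 2 : ℝ) with hr
  set E := excess γ L πopt ξ (M m) GH with hE
  have hEB (y) : E y ≤ B := by
    rcases y with _ | ⟨h, _ | s⟩
    · exact zero_le
    · exact tsub_le_self.trans (shiftedValue_le hγ₀ hγ₁ hL hR _ _ _)
    · exact zero_le
  have key (n : ℕ) : ∀ x, Possible (M m) x → E x ≤
      B * ∑ k ∈ Finset.range n, ENNReal.ofReal γ ^ k * expect (iter (step (M m) GH) k x) r +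
        ENNReal.ofReal γ ^ n * expect (iter (step (M m) GH) n x) E := by
    induction n with
    | zero => intro x hx; simp [iter]
    | succ n ih =>
      intro x hx
      refine (excess_le_step hw₁ hγ₀ hγ₁ hL hR hw hμ₁ hGH hx).trans ?_
      have h1 : expect (step (M m) GH x) E ≤ expect (step (M m) GH x) fun y =>
          B * ∑ k ∈ Finset.range n, ENNReal.ofReal γ ^ k * expect (iter (step (M m) GH) k y) r +
            ENNReal.ofReal γ ^ n * expect (iter (step (M m) GH) n y) E :=
        expect_mono_support fun y hy => ih y (possible_step hx hy)
      rw [expect_add, expect_const_mul, expect_const_mul, expect_finset_sum] at h1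
      simp only [expect_const_mul] at h1
      calc _ ≤ B * r x + ENNReal.ofReal γ * (B * ∑ k ∈ Finset.range n, ENNReal.ofReal γ ^ k *
              (expect (step (M m) GH x) fun y => expect (iter (step (M m) GH) k y) r) +
              ENNReal.ofReal γ ^ n *
              expect (step (M m) GH x) fun y => expect (iter (step (M m) GH) n y) E) := by
            gcongr
        _ = _ := by
            rw [Finset.sum_range_succ', pow_zero, one_mul]
            simp only [iter, expect_bind, expect_pure, pow_succ', mul_assoc, ← Finset.mul_sum]
            ring
  have hlim : Tendsto (fun n : ℕ => B * discountedSum γ (step (M m) GH) r x +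
      ENNReal.ofReal γ ^ n * B) atTop (𝓝 (B * discountedSum γ (step (M m) GH) r x + 0 * B)) := by
    refine Tendsto.add tendsto_const_nhds (ENNReal.Tendsto.mul_const ?_ (Or.inr ENNReal.ofReal_ne_top))
    exact ENNReal.tendsto_pow_atTop_nhds_zero_of_lt_one (by simpa using hγ₁)
  rw [zero_mul, add_zero] at hlim
  refine ge_of_tendsto' hlim fun n => (key n x hx).trans ?_
  gcongr
  · exact ENNReal.sum_le_tsum _
  · exact expect_le_const hEB

include hopt

omit hGH in
/-- Pessimism about a history that is followed by nonnegative rewards requires ignorance. -/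
theorem yields_le {x : Node A O R (RolloutState ι)} (hx : Possible (M m) x)
    (hpos : ∀ k y, iter (step (M m) GH) k x y ≠ 0 → 0 ≤ y.reward) :
    yields γ (mixture M w hw₁) x ≤ ENNReal.ofReal L *
      ∑' k : ℕ, ENNReal.ofReal (1 - γ) * ENNReal.ofReal γ ^ k * infoGain M w m GH (k + 1) x := by
  rcases x with _ | ⟨h, s⟩
  · exact zero_le
  rw [yields]
  split_ifs with hy
  swap
  · exact zero_le
  set x : Node A O R (RolloutState ι) := .running h s
  set I := ∑' k : ℕ, ENNReal.ofReal (1 - γ) * ENNReal.ofReal γ ^ k * infoGain M w m GH (k + 1) x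
  -- On outcomes reachable under the model, shifted rewards are at least `L`, and the mixture
  -- retains there a mass of at least 1 minus the information gain.
  have h1 : ENNReal.ofReal L ≤ shiftedValue γ L (mixture M w hw₁) GH x + ENNReal.ofReal L * I := by
    calc ENNReal.ofReal L = ∑' k : ℕ, ENNReal.ofReal (1 - γ) * ENNReal.ofReal γ ^ k *
            ENNReal.ofReal L := by rw [ENNReal.tsum_mul_right, tsum_discount hγ₀ hγ₁, one_mul]
      _ ≤ ∑' k : ℕ, (ENNReal.ofReal (1 - γ) * ENNReal.ofReal γ ^ k *
              expect (iter (step (mixture M w hw₁) GH) (k + 1) x) (shiftedReward L) +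
            ENNReal.ofReal L * (ENNReal.ofReal (1 - γ) * ENNReal.ofReal γ ^ k *
              infoGain M w m GH (k + 1) x)) := by
          refine ENNReal.tsum_le_tsum fun k => ?_
          have h2 : ENNReal.ofReal L ≤
              expect (iter (step (mixture M w hw₁) GH) (k + 1) x) (shiftedReward L) +
                ENNReal.ofReal L * infoGain M w m GH (k + 1) x := by
            calc ENNReal.ofReal L = ENNReal.ofReal L * 1 := (mul_one _).symm
              _ ≤ ENNReal.ofReal L * (_ + infoGain M w m GH (k + 1) x) :=
                mul_le_mul_right (one_le_expect_ratio_add_infoGain hw hw₁ hμ₁ GH (k + 1) hx) _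
              _ ≤ _ := by
                rw [mul_add]
                refine add_le_add ?_ le_rfl
                rw [← expect_const_mul]
                refine le_trans (expect_mono_support fun y hy => ?_)
                  (expect_iter_ratio_div_le hw hw₁ hμ₁ GH (k + 1) hx (shiftedReward L))
                rw [mul_comm]
                refine mul_le_mul_right (ENNReal.ofReal_le_ofReal ?_) _
                linarith [hpos _ y hy]
          calc _ ≤ ENNReal.ofReal (1 - γ) * ENNReal.ofReal γ ^ k * _ := mul_le_mul_right h2 _
            _ = _ := by ring
      _ = _ := by rw [ENNReal.tsum_add, ENNReal.tsum_mul_left]; rfl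
  have h2 := shiftedValue_le_opt hγ₀ hγ₁ hL hR hopt GH x
  rw [optValue_eq hγ₀ hγ₁ hL hR hopt] at hy
  set q := shiftedValue γ L (mixture M w hw₁) πopt.toAgent x.forget with hq
  change q.toReal - L ≤ -1 at hy
  have hq' : q ≠ ⊤ := shiftedValue_ne_top hγ₀ hγ₁ hL hR _ _ _
  -- The trigger leaves a gap of 1 below `L`, which only the information term `L * I` can fill.
  have h3 : q + 1 ≤ ENNReal.ofReal L := by
    rw [← ENNReal.ofReal_toReal hq', ← ENNReal.ofReal_one,
      ← ENNReal.ofReal_add ENNReal.toReal_nonneg zero_le_one]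
    exact ENNReal.ofReal_le_ofReal (by linarith)
  refine (ENNReal.add_le_add_iff_left hq').1 (h3.trans (h1.trans ?_))
  gcongr

end Excess

end GoldenHandcuffs

namespace GoldenHandcuffs

variable {A O N S ι : Type*} {R : Set ℝ}

/-! ### Summing discounted quantities over time. -/

section DiscountedSum

variable {X : Type*}

theorem discountedSum_add (γ : ℝ) (f : X → PMF X) (r r' : X → ℝ≥0∞) (x : X) :
    discountedSum γ f (fun y => r y + r' y) x =
      discountedSum γ f r x + discountedSum γ f r' x := by
  simp only [discountedSum, expect_add, mul_add, ENNReal.tsum_add]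

theorem tsum_geometric_ofReal {γ : ℝ} (hγ₀ : 0 < γ) (hγ₁ : γ < 1) :
    ∑' k : ℕ, ENNReal.ofReal γ ^ k = ENNReal.ofReal (1 / (1 - γ)) := by
  rw [ENNReal.tsum_geometric, one_sub_ofReal hγ₀, one_div,
    ENNReal.ofReal_inv_of_pos (by linarith)]

theorem discountedSum_sq_le {γ : ℝ} (hγ₀ : 0 < γ) (hγ₁ : γ < 1) (f : X → PMF X) (r : X → ℝ≥0∞)
    (x : X) : discountedSum γ f r x ^ 2 ≤
      ENNReal.ofReal (1 / (1 - γ)) * discountedSum γ f (fun y => r y ^ 2) x := by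
  refine (tsum_mul_sq_le _ _).trans ?_
  rw [tsum_geometric_ofReal hγ₀ hγ₁]
  refine mul_le_mul_right (ENNReal.tsum_le_tsum fun k => ?_) _
  exact mul_le_mul_right (expect_sq_le _ _) _

/-- The value of `r` at step s is counted at the times s - k with weight γ^k, in total at most 1/(1
- γ) times. -/
theorem sum_expect_discountedSum_le {γ : ℝ} (hγ₀ : 0 < γ) (hγ₁ : γ < 1) (f : X → PMF X)
    (r : X → ℝ≥0∞) (x : X) (T : ℕ) :
    ∑ t ∈ Finset.range T, expect (iter f t x) (discountedSum γ f r) ≤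
      ENNReal.ofReal (1 / (1 - γ)) * ∑' t : ℕ, expect (iter f t x) r := by
  have e (t : ℕ) : expect (iter f t x) (discountedSum γ f r) =
      ∑' k : ℕ, ENNReal.ofReal γ ^ k * expect (iter f (t + k) x) r := by
    unfold discountedSum
    rw [expect_tsum]
    refine tsum_congr fun k => ?_
    rw [expect_const_mul, iter_add, expect_bind]
  simp only [e]
  rw [← tsum_geometric_ofReal hγ₀ hγ₁, ← Summable.tsum_finsetSum fun _ _ => ENNReal.summable,
    ← ENNReal.tsum_mul_right]
  refine ENNReal.tsum_le_tsum fun k => ?_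
  rw [← Finset.mul_sum]
  refine mul_le_mul_right ?_ _
  refine (ENNReal.sum_le_tsum _).trans ?_
  exact ENNReal.tsum_comp_le_tsum_of_injective (add_left_injective k)
    (fun t => expect (iter f t x) r)

/-- The mean of a geometric variable. The total gain over windows of `k + 1` steps is proportional
to `k + 1`, so this is the total of the discounted gain. -/
theorem tsum_discount_mul_succ {γ : ℝ} (hγ₀ : 0 < γ) (hγ₁ : γ < 1) :
    ∑' k : ℕ, ENNReal.ofReal (1 - γ) * ENNReal.ofReal γ ^ k * ((k + 1 : ℕ) : ℝ≥0∞) =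
      ENNReal.ofReal (1 / (1 - γ)) := by
  have hn : ‖γ‖ < 1 := by rwa [Real.norm_of_nonneg hγ₀.le]
  have h1 := (hasSum_coe_mul_geometric_of_norm_lt_one hn).add
    (hasSum_geometric_of_lt_one hγ₀.le hγ₁)
  have h2 := h1.mul_left (1 - γ)
  have hpos : (1 - γ) ≠ 0 := by linarith
  have e : (1 - γ) * (γ / (1 - γ) ^ 2 + (1 - γ)⁻¹) = 1 / (1 - γ) := by
    field_simp
    ring
  rw [e] at h2
  rw [← h2.tsum_eq, ENNReal.ofReal_tsum_of_nonneg _ h2.summable]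
  · refine tsum_congr fun k => ?_
    rw [← ENNReal.ofReal_pow hγ₀.le, ← ENNReal.ofReal_mul (by linarith),
      ← ENNReal.ofReal_natCast, ← ENNReal.ofReal_mul (mul_nonneg (by linarith) (by positivity))]
    congr 1
    push_cast
    ring
  · intro k
    refine mul_nonneg (by linarith) (by positivity)

end DiscountedSum

section Squares

theorem add_sq_le (x y : ℝ≥0∞) : (x + y) ^ 2 ≤ 2 * x ^ 2 + 2 * y ^ 2 := by
  by_cases hx : x = ⊤
  · simp [hx]
  by_cases hy : y = ⊤
  · simp [hy]
  lift x to ℝ≥0 using hx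
  lift y to ℝ≥0 using hy
  norm_cast
  rw [← NNReal.coe_le_coe]
  push_cast
  nlinarith [sq_nonneg ((x : ℝ) - y)]

theorem sum_five_sq_le (x₁ x₂ x₃ x₄ x₅ : ℝ≥0∞) :
    (x₁ + x₂ + (x₃ + (x₄ + x₅))) ^ 2 ≤
      4 * x₁ ^ 2 + 4 * x₂ ^ 2 + 4 * x₃ ^ 2 + 8 * x₄ ^ 2 + 8 * x₅ ^ 2 := by
  have h1 := add_sq_le (x₁ + x₂) (x₃ + (x₄ + x₅))
  have h2 := add_sq_le x₁ x₂
  have h3 := add_sq_le x₃ (x₄ + x₅)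
  have h4 := add_sq_le x₄ x₅
  calc _ ≤ 2 * (2 * x₁ ^ 2 + 2 * x₂ ^ 2) +
        2 * (2 * x₃ ^ 2 + 2 * (2 * x₄ ^ 2 + 2 * x₅ ^ 2)) := by
        refine h1.trans ?_
        gcongr
        refine h3.trans ?_
        gcongr
    _ = _ := by ring

end Squares

section Length

theorem length_of_iter_ne_zero {ν : Environment A O R} {ag : Agent A O R S} {n : ℕ}
    {h h' : Hist A O R} {s s' : S} (hy : iter (step ν ag) n (.running h s) (.running h' s') ≠ 0) :
    h'.length = h.length + n := by
  induction n generalizing h s with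
  | zero =>
    rw [← PMF.mem_support_iff, iter, PMF.mem_support_pure_iff] at hy
    cases hy
    rfl
  | succ n ih =>
    simp only [iter, step, ← PMF.mem_support_iff, PMF.mem_support_bind_iff,
      PMF.mem_support_map_iff] at hy
    obtain ⟨_, ⟨as, _, o, _, rfl⟩, hy⟩ := hy
    rcases o with _ | e
    · simp [iter_step_ended] at hy
    · rw [ih hy, List.length_cons]
      omega

end Length

/-! ### Expected time spent in rollouts. -/

section Rollouts

variable (γ : ℝ) (ξ ν : Environment A O R) (πopt : Policy A O R) (mentor : ι → Policy A O R)
  (v : PMF ι) (yieldTo : Hist A O R → PMF ι)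

/-- Indicator of the event that a rollout is in progress. -/
noncomputable def inRollout : Node A O R (RolloutState ι) → ℝ≥0∞
  | .running _ (some _) => 1
  | _ => 0

/-- The number of remaining steps of the rollout in progress. -/
noncomputable def remaining : Node A O R (RolloutState ι) → ℝ≥0∞
  | .running _ (some (n, _)) => (n : ℕ)
  | _ => 0

theorem remaining_next_rollout_le (h : Hist A O R) (a : A) (n : ℕ) (i : ι)
    (o : Option (O × R)) : remaining (.next h a (rollout n i) o) ≤ n := by
  rcases o with _ | e
  · exact bot_le
  · cases n with
    | zero => exact zero_le
    | succ n => exact le_refl ((n.succPNat : ℕ) : ℝ≥0∞)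

/-- The remaining length serves as a potential that drops by one per rollout step. A new rollout
adds only H(t) - 1, because its first action belongs to a step that started in state `none`. -/
theorem inRollout_add_expect_le (h : Hist A O R) (s : RolloutState ι) :
    inRollout (.running h s) + expect
        (step ν (agentGH γ ξ πopt mentor v yieldTo) (.running h s)) remaining ≤
      remaining (.running h s) +
        eta (h.length + 1) * ((horizon γ (h.length + 1) - 1 : ℕ) : ℝ≥0∞) := by
  have hroll (n : ℕ) (i : ι) : (expect (act πopt mentor h (rollout n i)) fun as =>
      expect (ν.percept h as.1) fun o => remaining (.next h as.1 as.2 o)) ≤ (n - 1 : ℕ) := by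
    cases n with
    | zero =>
      rw [rollout, expect_act_none]
      exact expect_le_const fun a => expect_le_const fun o =>
        remaining_next_rollout_le h a 0 i o
    | succ n =>
      rw [expect_act_rollout]
      exact expect_le_const fun a => expect_le_const fun o => remaining_next_rollout_le h a n i o
  rw [expect_step_running]
  rcases s with _ | ⟨n, i⟩
  · rw [inRollout, remaining, zero_add, zero_add, expect_agentGH_none]
    · have h0 (a : A) (o : Option (O × R)) :
          remaining (.next h a (none : RolloutState ι) o) = 0 := by
        cases o <;> rfl
      simp only [h0, expect_const, ite_self, mul_zero, add_zero]
      exact mul_le_mul_right (expect_le_const fun i => hroll _ i) _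
    · simp
    · simp
  · rw [agentGH_some]
    have e : (some (n, i) : RolloutState ι) = rollout (n : ℕ) i := by
      obtain ⟨k, hk⟩ : ∃ k, (n : ℕ) = k + 1 := ⟨n - 1, by have := n.pos; omega⟩
      rw [hk, rollout]
      congr
      exact PNat.eq (by simpa using hk)
    rw [inRollout, remaining]
    refine le_add_right ?_
    have h1 := hroll n i
    rw [← e] at h1
    refine (add_le_add le_rfl h1).trans (le_of_eq ?_)
    norm_cast
    have := n.pos
    omega

theorem sum_expect_inRollout_le (T : ℕ) :
    ∑ t ∈ Finset.range T, expect
        (iter (step ν (agentGH γ ξ πopt mentor v yieldTo)) t (.running [] none)) inRollout ≤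
      ∑ t ∈ Finset.range T, eta (t + 1) * ((horizon γ (t + 1) - 1 : ℕ) : ℝ≥0∞) := by
  set f := step ν (agentGH γ ξ πopt mentor v yieldTo)
  have key : ∑ t ∈ Finset.range T, expect (iter f t (.running [] none)) inRollout +
      expect (iter f T (.running [] none)) remaining ≤
      ∑ t ∈ Finset.range T, eta (t + 1) * ((horizon γ (t + 1) - 1 : ℕ) : ℝ≥0∞) := by
    induction T with
    | zero => simp [iter, remaining]
    | succ T ih =>
      rw [Finset.sum_range_succ, Finset.sum_range_succ, add_assoc, iter_succ', expect_bind,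
        ← expect_add]
      have h1 : (expect (iter f T (.running [] none)) fun x =>
          inRollout x + expect (f x) remaining) ≤
          expect (iter f T (.running [] none)) fun x => remaining x +
            eta (T + 1) * ((horizon γ (T + 1) - 1 : ℕ) : ℝ≥0∞) := by
        refine expect_mono_support fun x hx => ?_
        rcases x with _ | ⟨h, s⟩
        · simp [f, step, inRollout, remaining]
        · have := length_of_iter_ne_zero hx
          simp only [List.length_nil, zero_add] at this
          rw [← this]
          exact inRollout_add_expect_le γ ξ ν πopt mentor v yieldTo h s
      rw [expect_add _ remaining, expect_const] at h1
      refine (add_le_add le_rfl h1).trans ?_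
      rw [← add_assoc]
      exact add_le_add ih le_rfl
  exact le_self_add.trans key

end Rollouts

end GoldenHandcuffs

namespace GoldenHandcuffs

variable {A O N S ι : Type*} {R : Set ℝ}

theorem eta_pos {t : ℕ} (ht : 0 < t) : 0 < eta t :=
  NNReal.rpow_pos (by exact_mod_cast ht)

theorem eta_anti {s t : ℕ} (hs : 0 < s) (hst : s ≤ t) : eta t ≤ eta s :=
  NNReal.rpow_le_rpow_of_nonpos (by exact_mod_cast hs) (by exact_mod_cast hst) (by norm_num)

/-! ### The agent against the mentors, pointwise and summed. -/

section

variable (γ : ℝ) (M : N → Environment A O R) (w : N → ℝ≥0) (m : N)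

/-- The expected discounted information gain about the model `m`. -/
noncomputable def discountedInfoGain (ag : Agent A O R S) (x : Node A O R S) : ℝ≥0∞ :=
  ∑' k : ℕ, ENNReal.ofReal (1 - γ) * ENNReal.ofReal γ ^ k * infoGain M w m ag (k + 1) x

variable {γ M w m} {L : ℝ} (hw₁ : ∑' n, (w n : ℝ≥0∞) ≤ 1)
  {πopt : Policy A O R} {mentor : ι → Policy A O R} {v : PMF ι} {yieldTo : Hist A O R → PMF ι}
  (hγ₀ : 0 < γ) (hγ₁ : γ < 1) (hL : 0 ≤ L)
  (hR : R ⊆ Set.Icc (-L) 1) (hw : 0 < w m) (hμ₁ : (M m).IsProper)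
  (hopt : IsBayesOptimal γ (mixture M w hw₁) πopt)
  {GH : Agent A O R (RolloutState ι)}
  (hGH : GH = agentGH γ (mixture M w hw₁) πopt mentor v yieldTo)

theorem tsum_truncated_discount {B : ℝ≥0∞} (hγ₀ : 0 < γ) (hγ₁ : γ < 1) (H : ℕ) :
    ∑' k : ℕ, ENNReal.ofReal (1 - γ) * ENNReal.ofReal γ ^ k * (if k < H then 0 else B) =
      B * ENNReal.ofReal γ ^ H := by
  rw [← ENNReal.summable.sum_add_tsum_nat_add' (k := H), Finset.sum_eq_zero, zero_add]
  · have e (k : ℕ) : ENNReal.ofReal (1 - γ) * ENNReal.ofReal γ ^ (k + H) *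
        (if k + H < H then 0 else B) =
        (B * ENNReal.ofReal γ ^ H) * (ENNReal.ofReal (1 - γ) * ENNReal.ofReal γ ^ k) := by
      rw [if_neg (by omega), pow_add]
      ring
    simp_rw [e]
    rw [ENNReal.tsum_mul_left, tsum_discount hγ₀ hγ₁, mul_one]
  · intro k hk
    rw [if_pos (Finset.mem_range.1 hk), mul_zero]

theorem ofReal_stateShortfall_le {μ : Environment A O R} (hγ₀ : 0 < γ) (hγ₁ : γ < 1) (hL : 0 ≤ L)
    (hR : R ⊆ Set.Icc (-L) 1) {ε : ℝ} {h : Hist A O R} {σ : RolloutState ι} {X : ℝ≥0∞}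
    (hX : ∀ i, ε ≤ (v i).toReal → shiftedValue γ L μ (mentor i).toAgent (.running h ()) ≤
      shiftedValue γ L μ GH (.running h σ) + X) :
    ENNReal.ofReal (stateShortfall γ μ GH mentor v ε (.running h σ)) ≤ X := by
  by_cases hX' : X = ⊤
  · simp [hX']
  refine ENNReal.ofReal_le_of_le_toReal (csSup_le (Set.insert_nonempty _ _) ?_)
  rintro _ (rfl | ⟨i, hi, rfl⟩)
  · exact ENNReal.toReal_nonneg
  · simp only
    rw [policyValue, value_eq hγ₀ hγ₁ hL hR, value_eq hγ₀ hγ₁ hL hR]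
    have hQ := shiftedValue_ne_top hγ₀ hγ₁ hL hR μ GH (.running h σ)
    have := ENNReal.toReal_mono (ENNReal.add_ne_top.2 ⟨hQ, hX'⟩) (hX i hi)
    rw [ENNReal.toReal_add hQ hX'] at this
    linarith

theorem discountedSum_exploreProb_le (hγ₀ : 0 < γ) (hγ₁ : γ < 1) {μ : Environment A O R}
    (h : Hist A O R) (σ : RolloutState ι) :
    discountedSum γ (step μ GH) exploreProb (.running h σ) ≤
      ENNReal.ofReal (1 / (1 - γ)) * eta (h.length + 1) := by
  rw [← tsum_geometric_ofReal hγ₀ hγ₁, ← ENNReal.tsum_mul_right]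
  refine ENNReal.tsum_le_tsum fun k => mul_le_mul_right ?_ _
  refine le_trans (expect_mono_support fun y hy => ?_) (expect_const _ _).le
  rcases y with _ | ⟨h', s⟩
  · exact zero_le
  · have := length_of_iter_ne_zero hy
    exact ENNReal.coe_le_coe.2 (eta_anti (by omega) (by omega))

include hγ₀ hγ₁ in
theorem le_shiftedValue_of_reward_nonneg {μ : Environment A O R} {ag : Agent A O R S}
    {x : Node A O R S}
    (hpos : ∀ k y, iter (step μ ag) k x y ≠ 0 → 0 ≤ y.reward) :
    ENNReal.ofReal L ≤ shiftedValue γ L μ ag x := by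
  calc ENNReal.ofReal L = ∑' k : ℕ, ENNReal.ofReal (1 - γ) * ENNReal.ofReal γ ^ k *
          ENNReal.ofReal L := by rw [ENNReal.tsum_mul_right, tsum_discount hγ₀ hγ₁, one_mul]
    _ ≤ _ := by
      refine ENNReal.tsum_le_tsum fun k => mul_le_mul_right ?_ _
      refine le_trans (expect_const _ _).ge (expect_mono_support fun y hy => ?_)
      exact ENNReal.ofReal_le_ofReal (by linarith [hpos _ y hy])

include hw₁ hγ₀ hγ₁ hw hμ₁

omit hγ₀ hγ₁ in
theorem tsum_expect_infoGain_le (ag : Agent A O R S) (s : S) (k : ℕ) :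
    ∑' t : ℕ, expect (iter (step (M m) ag) t (.running [] s)) (infoGain M w m ag k) ≤
      k * ENNReal.ofReal (Real.log (1 / (w m : ℝ))) := by
  rw [ENNReal.tsum_eq_iSup_nat]
  exact iSup_le fun T => sum_expect_infoGain_le hw hw₁ hμ₁ ag s T k

theorem tsum_expect_discountedInfoGain_le (ag : Agent A O R S) (s : S) :
    ∑' t : ℕ, expect (iter (step (M m) ag) t (.running [] s)) (discountedInfoGain γ M w m ag) ≤
      ENNReal.ofReal (1 / (1 - γ)) * ENNReal.ofReal (Real.log (1 / (w m : ℝ))) := by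
  unfold discountedInfoGain
  simp only [expect_tsum, expect_const_mul]
  rw [ENNReal.tsum_comm, ← tsum_discount_mul_succ hγ₀ hγ₁, ← ENNReal.tsum_mul_right]
  refine ENNReal.tsum_le_tsum fun k => ?_
  rw [ENNReal.tsum_mul_left, mul_assoc (_ * _)]
  exact mul_le_mul_right (tsum_expect_infoGain_le hw₁ hw hμ₁ ag s (k + 1)) _

include hL hR

-- Up to the horizon, the model is exchanged for the mixture at the cost of deficits; Cauchy-Schwarz
-- over the discount weights and `mul_divergence_mentor_le` turn these into the agent's information
-- gain. Rewards beyond the horizon matter by at most `L + 1`, with total weight γ^H.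
include hopt hGH in
theorem shiftedValue_mentor_le {ε : ℝ} (hε : 0 < ε) {h : Hist A O R}
    (hx : (M m).causal h ≠ 0) {i : ι} (hi : ε ≤ (v i).toReal) :
    shiftedValue γ L (M m) (mentor i).toAgent (.running h ()) ≤
      shiftedValue γ L (mixture M w hw₁) πopt.toAgent (.running h ()) +
        (ENNReal.ofReal (L + 1) * ENNReal.ofReal γ ^ horizon γ (h.length + 1) +
          ENNReal.ofReal (L + 1) * (2 * (discountedInfoGain γ M w m GH (.running h none) /
            (eta (h.length + 1) * ENNReal.ofReal ε))) ^ (1 / 2 : ℝ)) := by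
  set H := horizon γ (h.length + 1)
  set B := ENNReal.ofReal (L + 1)
  set c := fun k : ℕ => ENNReal.ofReal (1 - γ) * ENNReal.ofReal γ ^ k
  set d := fun k : ℕ => if k < H then
    deficit M w m (mentor i).toAgent (k + 1) (.running h ()) else 0
  have hx' : Possible (M m) (.running h () : Node A O R Unit) := hx
  have h1 : shiftedValue γ L (M m) (mentor i).toAgent (.running h ()) ≤
      shiftedValue γ L (mixture M w hw₁) (mentor i).toAgent (.running h ()) +
        (B * ENNReal.ofReal γ ^ H + B * ∑' k, c k * d k) := by
    rw [← tsum_truncated_discount hγ₀ hγ₁ H, ← ENNReal.tsum_mul_left, shiftedValue, shiftedValue,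
      ← ENNReal.tsum_add, ← ENNReal.tsum_add]
    refine ENNReal.tsum_le_tsum fun k => ?_
    rw [mul_left_comm B, ← mul_add, ← mul_add]
    refine mul_le_mul_right ?_ _
    by_cases hk : k < H
    · simp only [d, if_pos hk, zero_add]
      exact expect_model_le hw hw₁ hμ₁ _ _ hx' (shiftedReward_le hL hR)
    · simp only [d, if_neg hk, mul_zero, add_zero]
      exact le_add_left (expect_le_const (shiftedReward_le hL hR))
  have hη0 : ((eta (h.length + 1) : ℝ≥0) : ℝ≥0∞) ≠ 0 := by
    simpa using (eta_pos (Nat.succ_pos h.length)).ne'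
  have hε0 : ENNReal.ofReal ε ≠ 0 := by simpa using hε
  have h2 : ∑' k, c k * d k ≤ (2 * (discountedInfoGain γ M w m GH (.running h none) /
            (eta (h.length + 1) * ENNReal.ofReal ε))) ^ (1 / 2 : ℝ) := by
    rw [one_div, ENNReal.le_rpow_inv_iff (by norm_num), ENNReal.rpow_ofNat]
    refine (tsum_mul_sq_le c d).trans ?_
    rw [tsum_discount hγ₀ hγ₁, one_mul, ← mul_div_assoc, ENNReal.le_div_iff_mul_le
      (Or.inl (mul_ne_zero hη0 hε0))
      (Or.inl (ENNReal.mul_ne_top ENNReal.coe_ne_top ENNReal.ofReal_ne_top)),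
      discountedInfoGain, ← ENNReal.tsum_mul_left, ← ENNReal.tsum_mul_right]
    refine ENNReal.tsum_le_tsum fun k => ?_
    rw [mul_left_comm 2, mul_assoc]
    refine mul_le_mul_right ?_ _
    by_cases hk : k < H
    · have hv : ENNReal.ofReal ε ≤ v i := ENNReal.ofReal_le_of_le_toReal hi
      simp only [d, if_pos hk]
      calc _ ≤ 2 * divergence M w m (mentor i).toAgent (k + 1) (.running h ()) *
            (eta (h.length + 1) * v i) :=
            mul_le_mul' (deficit_sq_le hw hw₁ _ _ hx') (mul_le_mul_right hv _)
        _ = 2 * (eta (h.length + 1) * v i *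
            divergence M w m (mentor i).toAgent (k + 1) (.running h ())) := by ring
        _ ≤ 2 * divergence M w m GH (k + 1) (.running h none) :=
            mul_le_mul_right (mul_divergence_mentor_le hw₁ hGH i h hk) _
        _ ≤ _ := mul_le_mul_right (divergence_le_infoGain hw hw₁ hμ₁ GH (k + 1) (x := .running h none) hx) _
    · simp [d, hk]
  refine h1.trans (add_le_add ?_ (add_le_add le_rfl (mul_le_mul_right h2 _)))
  exact shiftedValue_policy_le hγ₀ hγ₁ hL hR hopt _ h

variable (hpos : ∀ t y, iter (step (M m) GH) t (.running [] none) y ≠ 0 → 0 ≤ y.reward)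
include hpos

-- Mentors have value at most 1, and nonnegative rewards give the agent value at least 0. This
-- covers histories in the middle of a rollout, where the information argument does not apply.
omit hw₁ hw hμ₁ in
theorem ofReal_stateShortfall_le_one (ε : ℝ) {t : ℕ} {x : Node A O R (RolloutState ι)}
    (hx : iter (step (M m) GH) t (.running [] none) x ≠ 0) :
    ENNReal.ofReal (stateShortfall γ (M m) GH mentor v ε x) ≤ 1 := by
  rcases x with _ | ⟨h, σ⟩
  · simp [stateShortfall]
  refine ofReal_stateShortfall_le hγ₀ hγ₁ hL hR fun i _ => ?_
  refine (shiftedValue_le hγ₀ hγ₁ hL hR _ _ _).trans ?_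
  rw [ENNReal.ofReal_add hL zero_le_one, ENNReal.ofReal_one]
  refine add_le_add ?_ le_rfl
  exact le_shiftedValue_of_reward_nonneg hγ₀ hγ₁ fun k y hy => hpos _ y (iter_pos_trans hx hy)

include hopt

theorem tsum_expect_yields_le :
    ∑' t : ℕ, expect (iter (step (M m) GH) t (.running [] none)) (yields γ (mixture M w hw₁)) ≤
      ENNReal.ofReal L * (ENNReal.ofReal (1 / (1 - γ)) *
        ENNReal.ofReal (Real.log (1 / (w m : ℝ)))) := by
  refine le_trans ?_
    (mul_le_mul_right (tsum_expect_discountedInfoGain_le hw₁ hγ₀ hγ₁ hw hμ₁ GH none) _)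
  rw [← ENNReal.tsum_mul_left]
  refine ENNReal.tsum_le_tsum fun t => ?_
  rw [← expect_const_mul]
  refine expect_mono_support fun x hx => ?_
  exact yields_le hw₁ hγ₀ hγ₁ hL hR hw hμ₁ hopt (possible_iter (x := .running [] none) one_ne_zero hx)
    fun k y hy => hpos _ y (iter_pos_trans hx hy)

include hGH

theorem ofReal_stateShortfall_sq_le {ε : ℝ} (hε : 0 < ε) {t : ℕ}
    {x : Node A O R (RolloutState ι)} (hx : iter (step (M m) GH) t (.running [] none) x ≠ 0) :
    ENNReal.ofReal (stateShortfall γ (M m) GH mentor v ε x) ^ 2 ≤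
      inRollout x + 4 * (ENNReal.ofReal (L + 1) * ENNReal.ofReal γ ^ horizon γ (t + 1)) ^ 2 +
      4 * (ENNReal.ofReal (L + 1) * (ENNReal.ofReal (1 / (1 - γ)) * eta (t + 1))) ^ 2 +
      4 * (ENNReal.ofReal (L + 1) ^ 2 * (ENNReal.ofReal (1 / (1 - γ)) *
        discountedSum γ (step (M m) GH) (yields γ (mixture M w hw₁)) x)) +
      8 * (ENNReal.ofReal (L + 1) ^ 2 * (2 * (discountedInfoGain γ M w m GH x /
            (eta (t + 1) * ENNReal.ofReal ε)))) +
      8 * (ENNReal.ofReal (L + 1) ^ 2 * (ENNReal.ofReal (1 / (1 - γ)) *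
        discountedSum γ (step (M m) GH) (fun y => 2 * infoGain M w m GH 1 y) x)) := by
  have hsqrt (y : ℝ≥0∞) : (y ^ (1 / 2 : ℝ)) ^ 2 = y := by
    rw [← ENNReal.rpow_natCast, ← ENNReal.rpow_mul]
    norm_num
  rcases x with _ | ⟨h, σ⟩
  · simp [stateShortfall]
  have hlen := length_of_iter_ne_zero hx
  simp only [List.length_nil, zero_add] at hlen
  subst hlen
  have hposs : Possible (M m) (.running h σ : Node A O R (RolloutState ι)) :=
    possible_iter (x := .running [] none) one_ne_zero hx
  rcases σ with _ | s
  swap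
  · have h1 := ofReal_stateShortfall_le_one (mentor := mentor) (v := v) hγ₀ hγ₁ hL hR hpos ε hx
    calc _ ≤ (1 : ℝ≥0∞) ^ 2 := pow_le_pow_left' h1 2
      _ = inRollout (.running h (some s)) := by simp [inRollout]
      _ ≤ _ := by
        simp only [add_assoc]
        exact le_self_add
  set x : Node A O R (RolloutState ι) := .running h none
  set B := ENNReal.ofReal (L + 1)
  set G := ENNReal.ofReal (1 / (1 - γ))
  have key : ENNReal.ofReal (stateShortfall γ (M m) GH mentor v ε x) ≤
      B * ENNReal.ofReal γ ^ horizon γ (h.length + 1) + B * (G * eta (h.length + 1)) +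
      (B * discountedSum γ (step (M m) GH) (yields γ (mixture M w hw₁)) x +
        (B * (2 * (discountedInfoGain γ M w m GH x /
            (eta (h.length + 1) * ENNReal.ofReal ε))) ^ (1 / 2 : ℝ) +
          B * discountedSum γ (step (M m) GH)
            (fun y => (2 * infoGain M w m GH 1 y) ^ (1 / 2 : ℝ)) x)) := by
    refine ofReal_stateShortfall_le hγ₀ hγ₁ hL hR fun i hi => ?_
    refine (shiftedValue_mentor_le hw₁ hγ₀ hγ₁ hL hR hw hμ₁ hopt hGH hε hposs hi).trans ?_
    have h1 := excess_le (x := x) hw₁ hγ₀ hγ₁ hL hR hw hμ₁ hGH hposs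
    rw [discountedSum_add, discountedSum_add] at h1
    have h2 : shiftedValue γ L (mixture M w hw₁) πopt.toAgent (.running h ()) ≤
        shiftedValue γ L (M m) GH x + excess γ L πopt (mixture M w hw₁) (M m) GH x :=
      le_add_tsub
    have h3 := discountedSum_exploreProb_le (GH := GH) hγ₀ hγ₁ (μ := M m) h none
    calc _ ≤ shiftedValue γ L (M m) GH x + B * (G * eta (h.length + 1) +
          discountedSum γ (step (M m) GH) (yields γ (mixture M w hw₁)) x +
          discountedSum γ (step (M m) GH)
            (fun y => (2 * infoGain M w m GH 1 y) ^ (1 / 2 : ℝ)) x) + _ := by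
          refine add_le_add (h2.trans (add_le_add le_rfl (h1.trans ?_))) le_rfl
          exact mul_le_mul_right (add_le_add (add_le_add h3 le_rfl) le_rfl) _
      _ = _ := by ring
  refine (pow_le_pow_left' key 2).trans ((sum_five_sq_le _ _ _ _ _).trans ?_)
  rw [show inRollout x = 0 from rfl, zero_add, mul_pow B (discountedSum _ _ _ _),
    mul_pow B (discountedSum _ _ _ _), mul_pow B ((2 * _) ^ (1 / 2 : ℝ)), hsqrt]
  have h1 := discountedSum_sq_le hγ₀ hγ₁ (step (M m) GH) (yields γ (mixture M w hw₁)) x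
  have h2 := discountedSum_sq_le hγ₀ hγ₁ (step (M m) GH)
    (fun y => (2 * infoGain M w m GH 1 y) ^ (1 / 2 : ℝ)) x
  simp only [hsqrt] at h2
  -- An indicator equals its square, so the trigger term stays linear in the information gain.
  have e : (fun y => yields γ (mixture M w hw₁) y ^ 2 : Node A O R (RolloutState ι) → ℝ≥0∞) =
      yields γ (mixture M w hw₁) := by
    funext y
    rcases y with _ | ⟨h, s⟩
    · simp [yields]
    · simp only [yields]
      split_ifs <;> simp
  rw [e] at h1
  gcongr

theorem sum_expect_stateShortfall_sq_le {ε : ℝ} (hε : 0 < ε) (T : ℕ) :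
    ∑ t ∈ Finset.range T, expect (iter (step (M m) GH) t (.running [] none))
        (fun x => ENNReal.ofReal (stateShortfall γ (M m) GH mentor v ε x) ^ 2) ≤
      ∑ t ∈ Finset.range T, eta (t + 1) * ((horizon γ (t + 1) - 1 : ℕ) : ℝ≥0∞) +
      ∑ t ∈ Finset.range T,
        4 * (ENNReal.ofReal (L + 1) * ENNReal.ofReal γ ^ horizon γ (t + 1)) ^ 2 +
      ∑ t ∈ Finset.range T,
        4 * (ENNReal.ofReal (L + 1) * (ENNReal.ofReal (1 / (1 - γ)) * eta (t + 1))) ^ 2 +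
      4 * (ENNReal.ofReal (L + 1) ^ 2 * (ENNReal.ofReal (1 / (1 - γ)) *
        (ENNReal.ofReal (1 / (1 - γ)) * (ENNReal.ofReal L * (ENNReal.ofReal (1 / (1 - γ)) *
          ENNReal.ofReal (Real.log (1 / (w m : ℝ)))))))) +
      8 * (ENNReal.ofReal (L + 1) ^ 2 * (2 * ((ENNReal.ofReal (1 / (1 - γ)) *
          ENNReal.ofReal (Real.log (1 / (w m : ℝ)))) / (eta T * ENNReal.ofReal ε)))) +
      8 * (ENNReal.ofReal (L + 1) ^ 2 * (ENNReal.ofReal (1 / (1 - γ)) *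
        (ENNReal.ofReal (1 / (1 - γ)) * (2 * ENNReal.ofReal (Real.log (1 / (w m : ℝ))))))) := by
  set f := step (M m) GH with hf
  set x₀ : Node A O R (RolloutState ι) := .running [] none
  have h0 (t : ℕ) (ht : t ∈ Finset.range T) :
      expect (iter f t x₀)
        (fun x => ENNReal.ofReal (stateShortfall γ (M m) GH mentor v ε x) ^ 2) ≤
      expect (iter f t x₀) inRollout +
      4 * (ENNReal.ofReal (L + 1) * ENNReal.ofReal γ ^ horizon γ (t + 1)) ^ 2 +
      4 * (ENNReal.ofReal (L + 1) * (ENNReal.ofReal (1 / (1 - γ)) * eta (t + 1))) ^ 2 +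
      4 * (ENNReal.ofReal (L + 1) ^ 2 * (ENNReal.ofReal (1 / (1 - γ)) *
        expect (iter f t x₀) (discountedSum γ f (yields γ (mixture M w hw₁))))) +
      8 * (ENNReal.ofReal (L + 1) ^ 2 * (2 * (expect (iter f t x₀) (discountedInfoGain γ M w m GH) /
            (eta T * ENNReal.ofReal ε)))) +
      8 * (ENNReal.ofReal (L + 1) ^ 2 * (ENNReal.ofReal (1 / (1 - γ)) *
        expect (iter f t x₀) (discountedSum γ f fun y => 2 * infoGain M w m GH 1 y))) := by
    refine (expect_mono_support fun x hx => ofReal_stateShortfall_sq_le hw₁ hγ₀ hγ₁ hL hR hw hμ₁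
      hopt hGH hpos hε hx).trans ?_
    simp only [expect_add, expect_const_mul, expect_const, div_eq_mul_inv]
    have e : (expect (iter (step (M m) GH) t x₀) fun x => discountedInfoGain γ M w m GH x *
        (eta (t + 1) * ENNReal.ofReal ε)⁻¹) =
        expect (iter f t x₀) (discountedInfoGain γ M w m GH) *
          (eta (t + 1) * ENNReal.ofReal ε)⁻¹ := by
      simp_rw [mul_comm _ ((eta (t + 1) * ENNReal.ofReal ε)⁻¹)]
      rw [expect_const_mul]
    rw [e]
    -- The exploration probability decreases; using its last value η(T) for all steps costs a factor
    -- T^{1/3} in the information term.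
    have hle : ((eta T : ℝ≥0) : ℝ≥0∞) ≤ eta (t + 1) :=
      ENNReal.coe_le_coe.2 (eta_anti (Nat.succ_pos t) (Finset.mem_range.1 ht))
    gcongr
  refine (Finset.sum_le_sum h0).trans ?_
  simp only [Finset.sum_add_distrib, ← Finset.mul_sum, div_eq_mul_inv, ← Finset.sum_mul]
  have h1 := sum_expect_inRollout_le γ (mixture M w hw₁) (M m) πopt mentor v yieldTo T
  rw [← hGH] at h1
  have h2 := (sum_expect_discountedSum_le hγ₀ hγ₁ f (yields γ (mixture M w hw₁)) x₀ T).trans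
    (mul_le_mul_right (tsum_expect_yields_le hw₁ hγ₀ hγ₁ hL hR hw hμ₁ hopt hpos) _)
  have h3 : ∑ t ∈ Finset.range T, expect (iter f t x₀) (discountedInfoGain γ M w m GH) ≤ _ :=
    (ENNReal.sum_le_tsum _).trans
      (tsum_expect_discountedInfoGain_le hw₁ hγ₀ hγ₁ hw hμ₁ GH none)
  have h4 : ∑ t ∈ Finset.range T,
      expect (iter f t x₀) (discountedSum γ f fun y => 2 * infoGain M w m GH 1 y) ≤
      ENNReal.ofReal (1 / (1 - γ)) * (2 * ENNReal.ofReal (Real.log (1 / (w m : ℝ)))) := by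
    refine (sum_expect_discountedSum_le hγ₀ hγ₁ f _ x₀ T).trans (mul_le_mul_right ?_ _)
    simp only [expect_const_mul, ENNReal.tsum_mul_left]
    refine mul_le_mul_right ?_ _
    simpa using tsum_expect_infoGain_le hw₁ hw hμ₁ GH none 1
  simp only [div_eq_mul_inv, one_mul] at h1 h2 h3 h4 ⊢
  gcongr

end

end GoldenHandcuffs

namespace GoldenHandcuffs

variable {A O N S ι : Type*} {R : Set ℝ}

/-! ### Sums of t^{-1/3} and t^{-2/3}, and the horizon. -/

section CubeRoots

/-- The cube root of a natural number. -/
noncomputable def cbrt (t : ℕ) : ℝ := (t : ℝ) ^ (1 / 3 : ℝ)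

theorem cbrt_nonneg (t : ℕ) : 0 ≤ cbrt t := by unfold cbrt; positivity

theorem cbrt_pos {t : ℕ} (ht : 0 < t) : 0 < cbrt t := by unfold cbrt; positivity

theorem cbrt_pow_three (t : ℕ) : cbrt t ^ 3 = t := by
  rw [cbrt, ← Real.rpow_natCast, ← Real.rpow_mul (by positivity)]
  norm_num

theorem cbrt_sq (t : ℕ) : cbrt t ^ 2 = (t : ℝ) ^ (2 / 3 : ℝ) := by
  rw [cbrt, ← Real.rpow_natCast, ← Real.rpow_mul (by positivity)]
  norm_num

theorem cbrt_le_cbrt {s t : ℕ} (h : s ≤ t) : cbrt s ≤ cbrt t :=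
  Real.rpow_le_rpow (by positivity) (by exact_mod_cast h) (by norm_num)

theorem coe_eta (t : ℕ) : (eta t : ℝ) = 1 / cbrt t := by
  rw [eta, NNReal.coe_rpow, NNReal.coe_natCast, Real.rpow_neg (by positivity), cbrt, one_div,
    one_div]

theorem eta_eq_ofReal (t : ℕ) : ((eta t : ℝ≥0) : ℝ≥0∞) = ENNReal.ofReal (1 / cbrt t) := by
  rw [← coe_eta, ENNReal.ofReal_coe_nnreal]

theorem sum_one_div_cbrt_le (T : ℕ) :
    ∑ t ∈ Finset.range T, 1 / cbrt (t + 1) ≤ 3 / 2 * cbrt T ^ 2 := by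
  induction T with
  | zero => simp; positivity
  | succ n ih =>
    rw [Finset.sum_range_succ]
    have hx := cbrt_nonneg n
    have hy := cbrt_pos (Nat.succ_pos n)
    have hxy := cbrt_le_cbrt (Nat.le_succ n)
    have h3 := cbrt_pow_three n
    have h4 := cbrt_pow_three (n + 1)
    simp only [Nat.succ_eq_add_one] at *
    set x := cbrt n
    set y := cbrt (n + 1)
    push_cast at h4
    have : 1 / y ≤ 3 / 2 * (y ^ 2 - x ^ 2) := by
      rw [div_le_iff₀ hy]
      -- Since y³ - x³ = 1, the claim amounts to (y - x)²(y + 2x) ≥ 0.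
      have h5 : 0 ≤ (y - x) * (y * (y - x) + 2 * x * (y - x)) :=
        mul_nonneg (by linarith) (add_nonneg (mul_nonneg hy.le (by linarith))
          (mul_nonneg (by positivity) (by linarith)))
      nlinarith [h5]
    linarith

theorem sum_one_div_cbrt_sq_le (T : ℕ) :
    ∑ t ∈ Finset.range T, (1 / cbrt (t + 1)) ^ 2 ≤ 3 * cbrt T := by
  induction T with
  | zero => simp [cbrt]
  | succ n ih =>
    rw [Finset.sum_range_succ]
    have hx := cbrt_nonneg n
    have hy := cbrt_pos (Nat.succ_pos n)
    have hxy := cbrt_le_cbrt (Nat.le_succ n)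
    have h3 := cbrt_pow_three n
    have h4 := cbrt_pow_three (n + 1)
    simp only [Nat.succ_eq_add_one] at *
    set x := cbrt n
    set y := cbrt (n + 1)
    push_cast at h4
    have : (1 / y) ^ 2 ≤ 3 * (y - x) := by
      rw [div_pow, one_pow, div_le_iff₀ (by positivity)]
      -- Here y³ - x³ = 1 reduces the claim to (y - x)²(2y + x) ≥ 0.
      have h5 : 0 ≤ (y - x) * ((y - x) * (2 * y + x)) :=
        mul_nonneg (by linarith) (mul_nonneg (by linarith) (by positivity))
      nlinarith [h5]
    linarith

theorem horizon_sub_one_le {γ : ℝ} (hγ₁ : γ < 1) {t : ℕ} (ht : 0 < t) :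
    ((horizon γ t - 1 : ℕ) : ℝ) ≤ Real.log t / (6 * (1 - γ)) := by
  have h0 : 0 ≤ Real.log t / (6 * (1 - γ)) :=
    div_nonneg (Real.log_nonneg (by exact_mod_cast ht)) (by linarith)
  rcases Nat.eq_zero_or_pos (horizon γ t) with h | h
  · simpa [h] using h0
  · have := Nat.ceil_lt_add_one h0
    rw [Nat.cast_sub h]
    unfold horizon
    push_cast
    linarith

/-- From log γ ≤ γ - 1 one gets 2H log γ ≤ -(ln t)/3; this is the purpose of the 6 in the horizon.
-/
theorem pow_horizon_sq_le {γ : ℝ} (hγ₀ : 0 < γ) (hγ₁ : γ < 1) {t : ℕ} (ht : 0 < t) :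
    (γ ^ horizon γ t) ^ 2 ≤ 1 / cbrt t := by
  have ht' : (0 : ℝ) < t := by exact_mod_cast ht
  have h1 : Real.log t ≤ 6 * (1 - γ) * horizon γ t := by
    have := Nat.le_ceil (Real.log t / (6 * (1 - γ)))
    rw [div_le_iff₀ (by linarith)] at this
    rw [mul_comm]
    exact this
  have h2 := Real.log_le_sub_one_of_pos hγ₀
  have h3 : (0 : ℝ) ≤ horizon γ t := by positivity
  rw [← Real.log_le_log_iff (by positivity) (one_div_pos.2 (cbrt_pos ht)), one_div, Real.log_inv,
    Real.log_pow, Real.log_pow, cbrt, Real.log_rpow ht']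
  push_cast
  nlinarith [mul_le_mul_of_nonneg_left h2 h3]

end CubeRoots

/-! ### The explicit bound. -/

section

variable {γ : ℝ} {M : N → Environment A O R} {w : N → ℝ≥0} {m : N} {L : ℝ}
  (hw₁ : ∑' n, (w n : ℝ≥0∞) ≤ 1)
  {πopt : Policy A O R} {mentor : ι → Policy A O R} {v : PMF ι} {yieldTo : Hist A O R → PMF ι}
  (hγ₀ : 0 < γ) (hγ₁ : γ < 1) (hL : 0 ≤ L)
  (hR : R ⊆ Set.Icc (-L) 1) (hw : 0 < w m) (hμ₁ : (M m).IsProper)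
  (hopt : IsBayesOptimal γ (mixture M w hw₁) πopt)
  {GH : Agent A O R (RolloutState ι)}
  (hGH : GH = agentGH γ (mixture M w hw₁) πopt mentor v yieldTo)

/-- The bound of the theorem, with `lam` for the logarithm of the inverse prior weight. -/
noncomputable def shortfallBound (γ L lam ε : ℝ) (T : ℕ) : ℝ :=
  1 / (4 * (1 - γ)) * (T : ℝ) ^ (2 / 3 : ℝ) * Real.log T
    + 12 * (L + 1) ^ 2 / (1 - γ) ^ 2 * (T : ℝ) ^ (1 / 3 : ℝ)
    + 8 * L * (L + 1) ^ 2 / (1 - γ) ^ 3 * lam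
    + 4 * (L + 2) ^ 2 / ε ^ 2 * (T : ℝ) ^ (2 / 3 : ℝ) * lam
    + 6 * (L + 1) ^ 2 * (T : ℝ) ^ (2 / 3 : ℝ)

include hγ₁ hL in
theorem shortfallBound_nonneg {lam : ℝ} (hlam : 0 ≤ lam) (ε : ℝ) (T : ℕ) :
    0 ≤ shortfallBound γ L lam ε T := by
  have h1 : 0 < 1 - γ := by linarith
  have h2 : 0 ≤ Real.log T := Real.log_natCast_nonneg T
  unfold shortfallBound
  positivity

-- Merges the two information terms into the single one of the theorem, with `s` standing for
-- T^{1/3}. The lower bound on `s` is available whenever the claimed bound is below `T`.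
include hγ₁ hL in
theorem information_terms_le {lam ε s : ℝ} (hlam : 0 ≤ lam) (hε : 0 < ε) (hε1 : ε ≤ 1)
    (hs : 0 < s) (h : 12 * (L + 1) ^ 2 * (1 / (1 - γ)) ^ 2 ≤ s ^ 2) :
    16 * (L + 1) ^ 2 * (1 / (1 - γ)) * lam * s / ε + 16 * (L + 1) ^ 2 * (1 / (1 - γ)) ^ 2 * lam ≤
      4 * (L + 2) ^ 2 / ε ^ 2 * s ^ 2 * lam := by
  have hG : 0 < 1 / (1 - γ) := one_div_pos.2 (by linarith)
  set G := 1 / (1 - γ)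
  -- The factor 3/10 is a rational number slightly above 1/√12.
  have hBG : (L + 1) * G ≤ 3 / 10 * s := by
    refine abs_le_of_sq_le_sq' ?_ (by positivity) |>.2
    nlinarith
  set q := 1 / ε
  have hq : 1 ≤ q := (one_le_div hε).2 hε1
  have e1 : 16 * (L + 1) ^ 2 * G * lam * s / ε = 16 * (L + 1) * lam * s * q * ((L + 1) * G) := by
    simp only [q]; ring
  have e2 : 16 * (L + 1) ^ 2 * G ^ 2 * lam = 4 / 3 * lam * (12 * (L + 1) ^ 2 * G ^ 2) := by ring
  have e3 : 4 * (L + 2) ^ 2 / ε ^ 2 * s ^ 2 * lam = 4 * (L + 2) ^ 2 * q ^ 2 * s ^ 2 * lam := by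
    simp only [q]; field_simp
  rw [e1, e2, e3]
  calc _ ≤ 16 * (L + 1) * lam * s * q * (3 / 10 * s) + 4 / 3 * lam * s ^ 2 := by gcongr
    _ = (24 / 5 * (L + 1) * q + 4 / 3) * (s ^ 2 * lam) := by ring
    _ ≤ (4 * (L + 2) ^ 2 * q ^ 2) * (s ^ 2 * lam) := by
      gcongr
      have h1 : 1 ≤ q ^ 2 := by nlinarith
      have h2 : q ≤ q ^ 2 := by nlinarith
      have h3 : (L + 1) * q ≤ (L + 1) * q ^ 2 := by gcongr
      have h4 : 0 ≤ L * q ^ 2 := by positivity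
      have h5 : 0 ≤ L ^ 2 * q ^ 2 := by positivity
      nlinarith
    _ = _ := by ring

variable (hpos : ∀ t y, iter (step (M m) GH) t (.running [] none) y ≠ 0 → 0 ≤ y.reward)
include hw₁ hγ₀ hγ₁ hL hR hw hμ₁ hopt hGH hpos

theorem sum_expect_stateShortfall_sq_le_bound {ε : ℝ} (hε : 0 < ε) (T : ℕ) :
    ∑ t ∈ Finset.range T, expect (iter (step (M m) GH) t (.running [] none))
        (fun x => ENNReal.ofReal (stateShortfall γ (M m) GH mentor v ε x) ^ 2) ≤
      ENNReal.ofReal (shortfallBound γ L (Real.log (1 / (w m : ℝ))) ε T) := by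
  have hlam : 0 ≤ Real.log (1 / (w m : ℝ)) := by
    refine Real.log_nonneg ((one_le_div (by exact_mod_cast hw)).2 (weight_le_one hw₁))
  set lam := Real.log (1 / (w m : ℝ)) with hlam'
  rcases Nat.eq_zero_or_pos T with rfl | hT
  · simp
  -- If ε > 1, no mentor has weight ε and the shortfall vanishes.
  rcases lt_or_ge 1 ε with hε1 | hε1
  · rw [Finset.sum_eq_zero]
    · exact zero_le
    intro t _
    rw [expect_eq_zero]
    intro x _
    rcases x with _ | ⟨h, σ⟩
    · simp [stateShortfall]
    rw [nonpos_iff_eq_zero.1 (ofReal_stateShortfall_le (X := 0) hγ₀ hγ₁ hL hR fun i hi => ?_)]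
    · simp
    · have h1 : (v i).toReal ≤ 1 := ENNReal.toReal_le_of_le_ofReal zero_le_one
        (by simpa using v.coe_le_one i)
      linarith
  -- Each summand is at most 1, so a bound of at least `T` holds trivially. Otherwise the T^{1/3}
  -- term alone is below `T`, which gives `hsmall`.
  rcases le_or_gt (T : ℝ) (shortfallBound γ L lam ε T) with hb | hb
  · calc _ ≤ ∑ t ∈ Finset.range T, (1 : ℝ≥0∞) := by
          refine Finset.sum_le_sum fun t _ => ?_
          refine (expect_mono_support fun x hx => ?_).trans (expect_const _ _).le
          have h1 := ofReal_stateShortfall_le_one (mentor := mentor) (v := v) hγ₀ hγ₁ hL hR hpos ε hx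
          simpa using pow_le_pow_left' h1 2
      _ = ENNReal.ofReal T := by simp
      _ ≤ _ := ENNReal.ofReal_le_ofReal hb
  have hγ' : 0 < 1 - γ := by linarith
  have hlogT : 0 ≤ Real.log T := Real.log_natCast_nonneg T
  have hs := cbrt_pos hT
  have hsmall : 12 * (L + 1) ^ 2 * (1 / (1 - γ)) ^ 2 ≤ cbrt T ^ 2 := by
    have h1 : 12 * (L + 1) ^ 2 / (1 - γ) ^ 2 * cbrt T ≤ shortfallBound γ L lam ε T := by
      have a1 : 0 ≤ 1 / (4 * (1 - γ)) * (T : ℝ) ^ (2 / 3 : ℝ) * Real.log T := by positivity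
      have a2 : 0 ≤ 8 * L * (L + 1) ^ 2 / (1 - γ) ^ 3 * lam := by positivity
      have a3 : 0 ≤ 4 * (L + 2) ^ 2 / ε ^ 2 * (T : ℝ) ^ (2 / 3 : ℝ) * lam := by positivity
      have a4 : 0 ≤ 6 * (L + 1) ^ 2 * (T : ℝ) ^ (2 / 3 : ℝ) := by positivity
      unfold shortfallBound cbrt
      linarith
    have h2 := (h1.trans_lt hb).le
    rw [← cbrt_pow_three] at h2
    have h3 : 12 * (L + 1) ^ 2 * (1 / (1 - γ)) ^ 2 * cbrt T ≤ cbrt T ^ 2 * cbrt T := by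
      calc _ = 12 * (L + 1) ^ 2 / (1 - γ) ^ 2 * cbrt T := by rw [one_div, inv_pow]; rfl
        _ ≤ _ := h2
        _ = _ := by ring
    exact le_of_mul_le_mul_right h3 hs
  have hinfo := information_terms_le hγ₁ hL hlam hε hε1 hs hsmall
  have hG : 0 < 1 / (1 - γ) := one_div_pos.2 hγ'
  refine (sum_expect_stateShortfall_sq_le hw₁ hγ₀ hγ₁ hL hR hw hμ₁ hopt hGH hpos hε T).trans ?_
  rw [← hlam']
  have t1 : ∑ t ∈ Finset.range T, eta (t + 1) * ((horizon γ (t + 1) - 1 : ℕ) : ℝ≥0∞) ≤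
      ENNReal.ofReal (1 / (4 * (1 - γ)) * (T : ℝ) ^ (2 / 3 : ℝ) * Real.log T) := by
    calc _ ≤ ∑ t ∈ Finset.range T, ENNReal.ofReal (1 / cbrt (t + 1) *
            (Real.log T / (6 * (1 - γ)))) := by
          refine Finset.sum_le_sum fun t ht => ?_
          rw [ENNReal.ofReal_mul (one_div_nonneg.2 (cbrt_nonneg _)), ← eta_eq_ofReal,
            ← ENNReal.ofReal_natCast]
          gcongr
          refine (horizon_sub_one_le hγ₁ (Nat.succ_pos t)).trans ?_
          gcongr
          · exact Finset.mem_range.1 ht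
      _ = ENNReal.ofReal ((∑ t ∈ Finset.range T, 1 / cbrt (t + 1)) *
            (Real.log T / (6 * (1 - γ)))) := by
          rw [← ENNReal.ofReal_sum_of_nonneg, Finset.sum_mul]
          intro t _
          exact mul_nonneg (one_div_nonneg.2 (cbrt_nonneg _)) (by positivity)
      _ ≤ _ := by
          refine ENNReal.ofReal_le_ofReal ?_
          calc _ ≤ 3 / 2 * cbrt T ^ 2 * (Real.log T / (6 * (1 - γ))) := by
                gcongr
                exact sum_one_div_cbrt_le T
            _ = _ := by rw [cbrt_sq]; field_simp; ring
  have t2 : ∑ t ∈ Finset.range T,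
      4 * (ENNReal.ofReal (L + 1) * ENNReal.ofReal γ ^ horizon γ (t + 1)) ^ 2 ≤
      ENNReal.ofReal (6 * (L + 1) ^ 2 * (T : ℝ) ^ (2 / 3 : ℝ)) := by
    calc _ ≤ ∑ t ∈ Finset.range T, ENNReal.ofReal (4 * ((L + 1) ^ 2 * (1 / cbrt (t + 1)))) := by
          refine Finset.sum_le_sum fun t ht => ?_
          rw [← ENNReal.ofReal_pow hγ₀.le, ← ENNReal.ofReal_mul (by linarith),
            ← ENNReal.ofReal_pow (by positivity), ENNReal.ofReal_mul (by norm_num)]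
          refine mul_le_mul' (by simp) (ENNReal.ofReal_le_ofReal ?_)
          rw [mul_pow]
          gcongr
          exact pow_horizon_sq_le hγ₀ hγ₁ (Nat.succ_pos t)
      _ = ENNReal.ofReal (4 * ((L + 1) ^ 2 * ∑ t ∈ Finset.range T, (1 / cbrt (t + 1)))) := by
          rw [← ENNReal.ofReal_sum_of_nonneg, Finset.mul_sum, Finset.mul_sum]
          intro t _
          have := one_div_nonneg.2 (cbrt_nonneg (t + 1))
          positivity
      _ ≤ _ := by
          refine ENNReal.ofReal_le_ofReal ?_
          calc _ ≤ 4 * ((L + 1) ^ 2 * (3 / 2 * cbrt T ^ 2)) := by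
                gcongr
                exact sum_one_div_cbrt_le T
            _ = _ := by rw [cbrt_sq]; ring
  have t3 : ∑ t ∈ Finset.range T,
      4 * (ENNReal.ofReal (L + 1) * (ENNReal.ofReal (1 / (1 - γ)) * eta (t + 1))) ^ 2 ≤
      ENNReal.ofReal (12 * (L + 1) ^ 2 / (1 - γ) ^ 2 * (T : ℝ) ^ (1 / 3 : ℝ)) := by
    calc _ = ∑ t ∈ Finset.range T, ENNReal.ofReal (4 * (((L + 1) ^ 2 * (1 / (1 - γ)) ^ 2) *
            (1 / cbrt (t + 1)) ^ 2)) := by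
          refine Finset.sum_congr rfl fun t ht => ?_
          have := one_div_nonneg.2 (cbrt_nonneg (t + 1))
          rw [eta_eq_ofReal, ← ENNReal.ofReal_mul hG.le, ← ENNReal.ofReal_mul (by linarith),
            ← ENNReal.ofReal_pow (by positivity), ENNReal.ofReal_mul (by norm_num), mul_pow,
            mul_pow, mul_assoc]
          simp
      _ = ENNReal.ofReal (4 * (((L + 1) ^ 2 * (1 / (1 - γ)) ^ 2) *
            ∑ t ∈ Finset.range T, (1 / cbrt (t + 1)) ^ 2)) := by
          rw [← ENNReal.ofReal_sum_of_nonneg, Finset.mul_sum, Finset.mul_sum]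
          intro t _
          positivity
      _ ≤ _ := by
          refine ENNReal.ofReal_le_ofReal ?_
          calc _ ≤ 4 * (((L + 1) ^ 2 * (1 / (1 - γ)) ^ 2) * (3 * cbrt T)) := by
                gcongr
                exact sum_one_div_cbrt_sq_le T
            _ = _ := by rw [cbrt]; field_simp; ring
  have h2 : (2 : ℝ≥0∞) = ENNReal.ofReal 2 := by simp
  have h4 : (4 : ℝ≥0∞) = ENNReal.ofReal 4 := by simp
  have h8 : (8 : ℝ≥0∞) = ENNReal.ofReal 8 := by simp
  have hB : 0 ≤ L + 1 := by linarith
  have t4 : 4 * (ENNReal.ofReal (L + 1) ^ 2 * (ENNReal.ofReal (1 / (1 - γ)) *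
        (ENNReal.ofReal (1 / (1 - γ)) * (ENNReal.ofReal L * (ENNReal.ofReal (1 / (1 - γ)) *
          ENNReal.ofReal lam))))) ≤
      ENNReal.ofReal (8 * L * (L + 1) ^ 2 / (1 - γ) ^ 3 * lam) := by
    rw [h4, ← ENNReal.ofReal_mul hG.le, ← ENNReal.ofReal_mul hL, ← ENNReal.ofReal_mul hG.le,
      ← ENNReal.ofReal_mul hG.le, ← ENNReal.ofReal_pow hB, ← ENNReal.ofReal_mul (by positivity),
      ← ENNReal.ofReal_mul (by norm_num)]
    refine ENNReal.ofReal_le_ofReal ?_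
    -- The summation produces the constant 4; the 8 of the theorem leaves slack.
    have h5 : 0 ≤ L * (L + 1) ^ 2 / (1 - γ) ^ 3 * lam := by positivity
    calc _ = 4 * (L * (L + 1) ^ 2 / (1 - γ) ^ 3 * lam) := by field_simp
      _ ≤ 8 * (L * (L + 1) ^ 2 / (1 - γ) ^ 3 * lam) := by linarith
      _ = _ := by ring
  have t5 : 8 * (ENNReal.ofReal (L + 1) ^ 2 * (2 * ((ENNReal.ofReal (1 / (1 - γ)) *
          ENNReal.ofReal lam) / (eta T * ENNReal.ofReal ε)))) +
      8 * (ENNReal.ofReal (L + 1) ^ 2 * (ENNReal.ofReal (1 / (1 - γ)) *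
        (ENNReal.ofReal (1 / (1 - γ)) * (2 * ENNReal.ofReal lam)))) ≤
      ENNReal.ofReal (4 * (L + 2) ^ 2 / ε ^ 2 * (T : ℝ) ^ (2 / 3 : ℝ) * lam) := by
    have hc : 0 < 1 / cbrt T := one_div_pos.2 hs
    rw [eta_eq_ofReal, h8, h2, ← ENNReal.ofReal_mul hG.le, ← ENNReal.ofReal_mul hc.le,
      ← ENNReal.ofReal_div_of_pos (by positivity), ← ENNReal.ofReal_mul (by norm_num),
      ← ENNReal.ofReal_mul (by norm_num), ← ENNReal.ofReal_mul hG.le, ← ENNReal.ofReal_mul hG.le,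
      ← ENNReal.ofReal_pow hB, ← ENNReal.ofReal_mul (sq_nonneg (L + 1)),
      ← ENNReal.ofReal_mul (sq_nonneg (L + 1)), ← ENNReal.ofReal_mul (by norm_num),
      ← ENNReal.ofReal_mul (by norm_num), ← ENNReal.ofReal_add (by positivity) (by positivity)]
    refine ENNReal.ofReal_le_ofReal (le_trans (le_of_eq ?_) (hinfo.trans (le_of_eq ?_)))
    · field_simp
      ring
    · rw [cbrt_sq]
  calc _ ≤ ENNReal.ofReal (1 / (4 * (1 - γ)) * (T : ℝ) ^ (2 / 3 : ℝ) * Real.log T) +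
        ENNReal.ofReal (6 * (L + 1) ^ 2 * (T : ℝ) ^ (2 / 3 : ℝ)) +
        ENNReal.ofReal (12 * (L + 1) ^ 2 / (1 - γ) ^ 2 * (T : ℝ) ^ (1 / 3 : ℝ)) +
        ENNReal.ofReal (8 * L * (L + 1) ^ 2 / (1 - γ) ^ 3 * lam) +
        ENNReal.ofReal (4 * (L + 2) ^ 2 / ε ^ 2 * (T : ℝ) ^ (2 / 3 : ℝ) * lam) := by
        rw [add_assoc _ (8 * _) (8 * _)]
        exact add_le_add (add_le_add (add_le_add (add_le_add t1 t2) t3) t4) t5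
    _ = _ := by
        rw [← ENNReal.ofReal_add (by positivity) (by positivity),
          ← ENNReal.ofReal_add (by positivity) (by positivity),
          ← ENNReal.ofReal_add (by positivity) (by positivity),
          ← ENNReal.ofReal_add (by positivity) (by positivity), shortfallBound]
        congr 1
        ring

end

end GoldenHandcuffs

namespace GoldenHandcuffs

variable {A O N S ι : Type*} {R : Set ℝ}

/-! ### Boundedness of values and shortfalls. -/

section Bounds

/-- The value at a node. -/
noncomputable def nodeValue (γ : ℝ) (ν : Environment A O R) (ag : Agent A O R S) :
    Node A O R S → ℝ
  | .ended => 0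
  | .running h s => value γ ν ag h s

theorem marginalValue_eq (γ : ℝ) (ν : Environment A O R) (ag : Agent A O R S) (s₀ : S)
    (h : Hist A O R) : marginalValue γ ν ag s₀ h = ∫ ω, nodeValue γ ν ag (ω h.length)
      ∂((law ν ag [] s₀)[|{ω | ∃ s, ω h.length = .running h s}]) := by
  unfold marginalValue
  congr 1

variable {γ L : ℝ} (hγ₀ : 0 < γ) (hγ₁ : γ < 1) (hL : 0 ≤ L) (hR : R ⊆ Set.Icc (-L) 1)
include hγ₀ hγ₁ hL hR

theorem value_mem (ν : Environment A O R) (ag : Agent A O R S) (h : Hist A O R) (s : S) :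
    value γ ν ag h s ∈ Set.Icc (-L) 1 := by
  rw [value_eq hγ₀ hγ₁ hL hR]
  have h1 : (shiftedValue γ L ν ag (.running h s)).toReal ≤ L + 1 :=
    ENNReal.toReal_le_of_le_ofReal (by linarith) (shiftedValue_le hγ₀ hγ₁ hL hR _ _ _)
  have h2 : 0 ≤ (shiftedValue γ L ν ag (.running h s)).toReal := ENNReal.toReal_nonneg
  constructor <;> linarith

theorem abs_value_le (ν : Environment A O R) (ag : Agent A O R S) (h : Hist A O R) (s : S) :
    |value γ ν ag h s| ≤ L + 1 := by
  have := value_mem hγ₀ hγ₁ hL hR ν ag h s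
  rw [abs_le]
  constructor <;> linarith [this.1, this.2]

theorem abs_nodeValue_le (ν : Environment A O R) (ag : Agent A O R S) (x : Node A O R S) :
    |nodeValue γ ν ag x| ≤ L + 1 := by
  rcases x with _ | ⟨h, s⟩
  · simp only [nodeValue, abs_zero]
    linarith
  · exact abs_value_le hγ₀ hγ₁ hL hR ν ag h s

theorem abs_marginalValue_le (ν : Environment A O R) (ag : Agent A O R S) (s₀ : S)
    (h : Hist A O R) : |marginalValue γ ν ag s₀ h| ≤ L + 1 := by
  have : IsProbabilityMeasure (law ν ag [] s₀) := by unfold law; infer_instance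
  set S' := {ω : ℕ → Node A O R S | ∃ s, ω h.length = .running h s}
  -- Conditioning on a null event yields the zero measure, so only total mass at most 1 is
  -- available.
  have : IsFiniteMeasure ((law ν ag [] s₀)[|S']) := by
    unfold ProbabilityTheory.cond
    by_cases hS : law ν ag [] s₀ S' = 0
    · rw [Measure.restrict_eq_zero.2 hS, smul_zero]
      infer_instance
    · have := cond_isProbabilityMeasure hS
      exact inferInstanceAs (IsFiniteMeasure ((law ν ag [] s₀)[|S']))
  rw [marginalValue_eq]
  refine (norm_integral_le_of_norm_le_const (μ := (law ν ag [] s₀)[|S']) (C := L + 1)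
    (f := fun ω => nodeValue γ ν ag (ω h.length)) (ae_of_all _ fun ω => abs_nodeValue_le hγ₀ hγ₁ hL hR ν ag _)).trans ?_
  refine mul_le_of_le_one_right (by linarith) ?_
  · by_cases hS : law ν ag [] s₀ S' = 0
    · rw [cond_eq_zero_of_meas_eq_zero hS]
      simp
    · have := cond_isProbabilityMeasure hS
      exact probReal_univ.le

variable (μ : Environment A O R) (GH : Agent A O R (RolloutState ι)) (mentor : ι → Policy A O R)
  (v : PMF ι) (ε : ℝ)

theorem bddAbove_shortfall (h : Hist A O R) :
    BddAbove (insert (marginalValue γ μ GH none h)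
        ((fun i => policyValue γ μ (mentor i) h) '' {i | ε ≤ (v i).toReal})) := by
  refine ⟨L + 1, ?_⟩
  rintro _ (rfl | ⟨i, _, rfl⟩)
  · exact (abs_le.1 (abs_marginalValue_le hγ₀ hγ₁ hL hR μ GH none h)).2
  · exact (abs_le.1 (abs_value_le hγ₀ hγ₁ hL hR μ _ h ())).2

theorem bddAbove_stateShortfall (h : Hist A O R) (σ : RolloutState ι) :
    BddAbove (insert 0 ((fun i => policyValue γ μ (mentor i) h - value γ μ GH h σ) ''
      {i | ε ≤ (v i).toReal})) := by
  refine ⟨L + 1, ?_⟩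
  rintro _ (rfl | ⟨i, _, rfl⟩)
  · linarith
  · have h1 := (value_mem hγ₀ hγ₁ hL hR μ (mentor i).toAgent h ()).2
    have h2 := (value_mem hγ₀ hγ₁ hL hR μ GH h σ).1
    simp only [policyValue]
    linarith

theorem shortfall_nonneg (x : Node A O R (RolloutState ι)) :
    0 ≤ shortfall γ μ GH mentor v ε x := by
  rcases x with _ | ⟨h, σ⟩
  · exact le_rfl
  · exact sub_nonneg.2
      (le_csSup (bddAbove_shortfall hγ₀ hγ₁ hL hR μ GH mentor v ε h) (Set.mem_insert _ _))

theorem stateShortfall_nonneg (x : Node A O R (RolloutState ι)) :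
    0 ≤ stateShortfall γ μ GH mentor v ε x := by
  rcases x with _ | ⟨h, σ⟩
  · exact le_rfl
  · exact le_csSup (bddAbove_stateShortfall hγ₀ hγ₁ hL hR μ GH mentor v ε h σ) (Set.mem_insert _ _)

theorem shortfall_le (x : Node A O R (RolloutState ι)) :
    shortfall γ μ GH mentor v ε x ≤ 2 * (L + 1) := by
  rcases x with _ | ⟨h, σ⟩
  · simp only [shortfall]
    linarith
  · have h1 := abs_le.1 (abs_marginalValue_le hγ₀ hγ₁ hL hR μ GH none h)
    have h2 : sSup _ ≤ L + 1 := csSup_le (Set.insert_nonempty (marginalValue γ μ GH none h)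
        ((fun i => policyValue γ μ (mentor i) h) '' {i | ε ≤ (v i).toReal})) (by
      rintro _ (rfl | ⟨i, _, rfl⟩)
      · exact h1.2
      · exact (abs_le.1 (abs_value_le hγ₀ hγ₁ hL hR μ _ h ())).2)
    simp only [shortfall]
    linarith [h1.1]

theorem stateShortfall_le (x : Node A O R (RolloutState ι)) :
    stateShortfall γ μ GH mentor v ε x ≤ L + 1 := by
  rcases x with _ | ⟨h, σ⟩
  · simp only [stateShortfall]
    linarith
  · refine csSup_le (Set.insert_nonempty _ _) ?_
    rintro _ (rfl | ⟨i, _, rfl⟩)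
    · linarith
    · have h1 := (value_mem hγ₀ hγ₁ hL hR μ (mentor i).toAgent h ()).2
      have h2 := (value_mem hγ₀ hγ₁ hL hR μ GH h σ).1
      simp only [policyValue]
      linarith

end Bounds

section Measurability

variable {X : Type*} [MeasurableSpace X] [DiscreteMeasurableSpace X]

theorem measurable_coordinate {Y : Type*} [MeasurableSpace Y] (F : X → Y) (n : ℕ) :
    Measurable fun ω : ℕ → X => F (ω n) :=
  Measurable.of_discrete.comp (measurable_pi_apply n)

theorem integrable_coordinate {Q : Measure (ℕ → X)} [IsFiniteMeasure Q] {F : X → ℝ} {C : ℝ}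
    (hF : ∀ x, |F x| ≤ C) (n : ℕ) : Integrable (fun ω => F (ω n)) Q :=
  Integrable.of_bound (measurable_coordinate F n).aestronglyMeasurable C
    (ae_of_all _ fun ω => hF (ω n))

end Measurability

/-! ### Averaging over the hidden state. -/

section Jensen

variable {γ L : ℝ} (hγ₀ : 0 < γ) (hγ₁ : γ < 1) (hL : 0 ≤ L) (hR : R ⊆ Set.Icc (-L) 1)
  (μ : Environment A O R) (GH : Agent A O R (RolloutState ι)) (mentor : ι → Policy A O R)
  (v : PMF ι) (ε : ℝ)
include hγ₀ hγ₁ hL hR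

theorem abs_shortfall_sq_le (x : Node A O R (RolloutState ι)) :
    |shortfall γ μ GH mentor v ε x ^ 2| ≤ (2 * (L + 1)) ^ 2 := by
  rw [abs_of_nonneg (sq_nonneg _)]
  exact pow_le_pow_left₀ (shortfall_nonneg hγ₀ hγ₁ hL hR μ GH mentor v ε x)
    (shortfall_le hγ₀ hγ₁ hL hR μ GH mentor v ε x) 2

theorem abs_stateShortfall_sq_le (x : Node A O R (RolloutState ι)) :
    |stateShortfall γ μ GH mentor v ε x ^ 2| ≤ (L + 1) ^ 2 := by
  rw [abs_of_nonneg (sq_nonneg _)]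
  exact pow_le_pow_left₀ (stateShortfall_nonneg hγ₀ hγ₁ hL hR μ GH mentor v ε x)
    (stateShortfall_le hγ₀ hγ₁ hL hR μ GH mentor v ε x) 2

/-- Given `h`, mentor values are constants and the agent's marginal value is the mean of its state
values, so the maximal gap is at most the mean of the maximal gaps. Jensen then moves the square
inside. -/
theorem shortfall_sq_le_integral (h : Hist A O R) (σ : RolloutState ι)
    (hS : law μ GH [] none {ω | ∃ s, ω h.length = .running h s} ≠ 0) :
    shortfall γ μ GH mentor v ε (.running h σ) ^ 2 ≤
      ∫ ω, stateShortfall γ μ GH mentor v ε (ω h.length) ^ 2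
        ∂((law μ GH [] none)[|{ω | ∃ s, ω h.length = .running h s}]) := by
  have : IsProbabilityMeasure (law μ GH [] none) := by unfold law; infer_instance
  set S' := {ω : ℕ → Node A O R (RolloutState ι) | ∃ s, ω h.length = .running h s}
  set Q := (law μ GH [] none)[|S'] with hQ
  have : IsProbabilityMeasure Q := cond_isProbabilityMeasure hS
  have hS'm : MeasurableSet S' :=
    MeasurableSet.of_discrete.preimage (measurable_pi_apply h.length)
      (t := {x : Node A O R (RolloutState ι) | ∃ s, x = .running h s})
  have hae : ∀ᵐ ω ∂Q, ω ∈ S' := ae_cond_mem hS'm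
  have hSSi : Integrable (fun ω : ℕ → Node A O R (RolloutState ι) =>
      stateShortfall γ μ GH mentor v ε (ω h.length)) Q :=
    integrable_coordinate (C := L + 1) (fun x => by
      rw [abs_of_nonneg (stateShortfall_nonneg hγ₀ hγ₁ hL hR μ GH mentor v ε x)]
      exact stateShortfall_le hγ₀ hγ₁ hL hR μ GH mentor v ε x) _
  have hVi : Integrable (fun ω : ℕ → Node A O R (RolloutState ι) =>
      nodeValue γ μ GH (ω h.length)) Q :=
    integrable_coordinate (abs_nodeValue_le hγ₀ hγ₁ hL hR μ GH) _
  have h1 : shortfall γ μ GH mentor v ε (.running h σ) ≤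
      ∫ ω, stateShortfall γ μ GH mentor v ε (ω h.length) ∂Q := by
    have h0 : 0 ≤ ∫ ω, stateShortfall γ μ GH mentor v ε (ω h.length) ∂Q :=
      integral_nonneg fun ω => stateShortfall_nonneg hγ₀ hγ₁ hL hR μ GH mentor v ε _
    simp only [shortfall]
    rw [sub_le_iff_le_add']
    refine csSup_le (Set.insert_nonempty _ _) ?_
    rintro _ (rfl | ⟨i, hi, rfl⟩)
    · linarith
    · simp only
      rw [marginalValue_eq, ← hQ, ← integral_add hVi hSSi]
      have hc : ∫ _ : ℕ → Node A O R (RolloutState ι), policyValue γ μ (mentor i) h ∂Q =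
          policyValue γ μ (mentor i) h := by simp
      rw [← hc]
      refine integral_mono_ae (integrable_const _) (hVi.add hSSi) ?_
      filter_upwards [hae] with ω ⟨s, hs⟩
      simp only [hs]
      have := le_csSup (bddAbove_stateShortfall hγ₀ hγ₁ hL hR μ GH mentor v ε h s)
        (Set.mem_insert_of_mem _ ⟨i, hi, rfl⟩)
      simp only [stateShortfall, nodeValue]
      linarith
  refine (pow_le_pow_left₀ (shortfall_nonneg hγ₀ hγ₁ hL hR μ GH mentor v ε _) h1 2).trans ?_
  exact (even_two.convexOn_pow (𝕜 := ℝ)).map_integral_le (by fun_prop) isClosed_univ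
    (ae_of_all _ fun _ => Set.mem_univ _) hSSi
    (integrable_coordinate (abs_stateShortfall_sq_le hγ₀ hγ₁ hL hR μ GH mentor v ε) _)

/-- Partition by the countably many histories at time `n` and apply the conditional inequality on
each piece of positive probability. -/
theorem integral_shortfall_sq_le [Countable (Hist A O R)] (n : ℕ) :
    ∫ ω, shortfall γ μ GH mentor v ε (ω n) ^ 2 ∂(law μ GH [] none) ≤
      ∫ ω, stateShortfall γ μ GH mentor v ε (ω n) ^ 2 ∂(law μ GH [] none) := by
  have : IsProbabilityMeasure (law μ GH [] none) := by unfold law; infer_instance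
  set P := law μ GH [] none with hP
  let E : Hist A O R → Set (ℕ → Node A O R (RolloutState ι)) :=
    fun h => {ω | ∃ s, ω n = .running h s}
  have hEm (h) : MeasurableSet (E h) :=
    MeasurableSet.of_discrete.preimage (measurable_pi_apply n)
      (t := {x : Node A O R (RolloutState ι) | ∃ s, x = .running h s})
  have hdisj : Pairwise (Function.onFun Disjoint E) := by
    intro h h' hne
    rw [Function.onFun, Set.disjoint_left]
    rintro ω ⟨s, hs⟩ ⟨s', hs'⟩
    rw [hs] at hs'
    cases hs'
    exact hne rfl
  have hi1 : Integrable (fun ω => shortfall γ μ GH mentor v ε (ω n) ^ 2) P :=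
    integrable_coordinate (abs_shortfall_sq_le hγ₀ hγ₁ hL hR μ GH mentor v ε) n
  have hi2 : Integrable (fun ω => stateShortfall γ μ GH mentor v ε (ω n) ^ 2) P :=
    integrable_coordinate (abs_stateShortfall_sq_le hγ₀ hγ₁ hL hR μ GH mentor v ε) n
  -- `marginalValue` conditions on coordinate `h.length`; for histories of positive probability at
  -- time `n` this is coordinate `n`.
  have hlen (h : Hist A O R) (hP0 : P (E h) ≠ 0) : h.length = n := by
    by_contra hne
    have hae : ∀ᵐ ω ∂chainLaw (step μ GH) (.running [] none), ¬ ∃ s, ω n = .running h s := by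
      rw [ae_chainLaw_iff (f := step μ GH) (x := .running [] none) (n := n)
        (p := fun x => ¬ ∃ s, x = .running h s)]
      rintro y hy ⟨s, rfl⟩
      exact hne (by simpa using length_of_iter_ne_zero hy)
    exact hP0 (measure_eq_zero_iff_ae_notMem.2 hae)
  have hpiece (h : Hist A O R) : ∫ ω in E h, shortfall γ μ GH mentor v ε (ω n) ^ 2 ∂P ≤
      ∫ ω in E h, stateShortfall γ μ GH mentor v ε (ω n) ^ 2 ∂P := by
    by_cases hP0 : P (E h) = 0
    · rw [Measure.restrict_eq_zero.2 hP0]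
      simp
    have hl := hlen h hP0
    subst hl
    have hreal : 0 < P.real (E h) := ENNReal.toReal_pos hP0 (measure_ne_top _ _)
    have h1 := shortfall_sq_le_integral hγ₀ hγ₁ hL hR μ GH mentor v ε h none hP0
    rw [ProbabilityTheory.cond, integral_smul_measure, ENNReal.toReal_inv, smul_eq_mul,
      inv_mul_eq_div] at h1
    have h2 := (le_div_iff₀ hreal).1 h1
    calc _ = ∫ ω in E h, shortfall γ μ GH mentor v ε (.running h none) ^ 2 ∂P := by
          refine setIntegral_congr_fun (hEm h) ?_
          rintro ω ⟨s, hs⟩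
          simp only [hs]
          rfl
      _ = shortfall γ μ GH mentor v ε (.running h none) ^ 2 * P.real (E h) := by
          rw [setIntegral_const, smul_eq_mul, mul_comm]
      _ ≤ _ := h2
  have hs1 := hasSum_integral_iUnion hEm hdisj hi1.integrableOn
  have hs2 := hasSum_integral_iUnion hEm hdisj hi2.integrableOn
  calc _ = ∫ ω in ⋃ h, E h, shortfall γ μ GH mentor v ε (ω n) ^ 2 ∂P := by
        rw [setIntegral_eq_integral_of_forall_compl_eq_zero]
        intro ω hω
        rcases hx : ω n with _ | ⟨h, s⟩
        · simp [shortfall]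
        · exact absurd ((Set.mem_iUnion (s := E)).2 ⟨h, s, hx⟩) hω
    _ ≤ ∫ ω in ⋃ h, E h, stateShortfall γ μ GH mentor v ε (ω n) ^ 2 ∂P := hasSum_le hpiece hs1 hs2
    _ ≤ _ := setIntegral_le_integral hi2 (ae_of_all _ fun ω => sq_nonneg _)

end Jensen

/-! ### Growth of the bound. -/

section Limit

/-- With the threshold ε/log₂ T the largest growth is T^{2/3} (log T)², and T^ε dominates the
squared logarithm. -/
theorem tendsto_shortfallBound (γ L lam : ℝ) {ε : ℝ} (hε : 0 < ε) :
    Tendsto (fun T : ℕ => shortfallBound γ L lam (ε / Real.logb 2 T) T / (T : ℝ) ^ (2 / 3 + ε : ℝ))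
      atTop (𝓝 0) := by
  have hz (a : ℝ) (ha : 0 < a) : Tendsto (fun x : ℝ => x ^ (-a)) atTop (𝓝 0) :=
    tendsto_rpow_neg_atTop ha
  have hlog : Tendsto (fun x : ℝ => Real.log x * x ^ (-ε)) atTop (𝓝 0) := by
    have := (isLittleO_log_rpow_atTop hε).tendsto_div_nhds_zero
    refine this.congr' ?_
    filter_upwards [eventually_gt_atTop 0] with x hx
    rw [Real.rpow_neg hx.le]
    rfl
  have hlog2 : Tendsto (fun x : ℝ => Real.log x ^ 2 * x ^ (-ε)) atTop (𝓝 0) := by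
    have := (isLittleO_log_rpow_rpow_atTop 2 hε).tendsto_div_nhds_zero
    refine this.congr' ?_
    filter_upwards [eventually_gt_atTop 0] with x hx
    rw [Real.rpow_neg hx.le, Real.rpow_ofNat]
    rfl
  have main : Tendsto (fun x : ℝ =>
      1 / (4 * (1 - γ)) * (Real.log x * x ^ (-ε))
        + 12 * (L + 1) ^ 2 / (1 - γ) ^ 2 * x ^ (-(1 / 3 + ε))
        + 8 * L * (L + 1) ^ 2 / (1 - γ) ^ 3 * lam * x ^ (-(2 / 3 + ε))
        + 4 * (L + 2) ^ 2 * lam / (ε * Real.log 2) ^ 2 * (Real.log x ^ 2 * x ^ (-ε))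
        + 6 * (L + 1) ^ 2 * x ^ (-ε)) atTop (𝓝 0) := by
    have := ((((hlog.const_mul (1 / (4 * (1 - γ)))).add
      ((hz (1 / 3 + ε) (by linarith)).const_mul (12 * (L + 1) ^ 2 / (1 - γ) ^ 2))).add
      ((hz (2 / 3 + ε) (by linarith)).const_mul (8 * L * (L + 1) ^ 2 / (1 - γ) ^ 3 * lam))).add
      (hlog2.const_mul (4 * (L + 2) ^ 2 * lam / (ε * Real.log 2) ^ 2))).add
      ((hz ε hε).const_mul (6 * (L + 1) ^ 2))
    simpa using this
  refine (main.comp tendsto_natCast_atTop_atTop).congr' ?_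
  filter_upwards [eventually_ge_atTop 2] with T hT
  have hx : (0 : ℝ) < T := by positivity
  have hl2 : Real.log 2 ≠ 0 := (Real.log_pos one_lt_two).ne'
  have hlT : Real.log T ≠ 0 := (Real.log_pos (by exact_mod_cast hT)).ne'
  simp only [Function.comp_apply, shortfallBound]
  set x : ℝ := (T : ℝ)
  have e1 : x ^ (-ε) = x ^ (2 / 3 : ℝ) / x ^ (2 / 3 + ε : ℝ) := by
    rw [← Real.rpow_sub hx]
    ring_nf
  have e2 : x ^ (-(1 / 3 + ε)) = x ^ (1 / 3 : ℝ) / x ^ (2 / 3 + ε : ℝ) := by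
    rw [← Real.rpow_sub hx]
    ring_nf
  have e3 : x ^ (-(2 / 3 + ε)) = 1 / x ^ (2 / 3 + ε : ℝ) := by
    rw [Real.rpow_neg hx.le, one_div]
  have e4 : 4 * (L + 2) ^ 2 / (ε / Real.logb 2 x) ^ 2 =
      4 * (L + 2) ^ 2 / (ε * Real.log 2) ^ 2 * Real.log x ^ 2 := by
    rw [Real.logb]
    field_simp
  rw [e1, e2, e3, e4]
  ring

end Limit

end GoldenHandcuffs

namespace GoldenHandcuffs

theorem sum_Icc_sub_one {E : Type*} [AddCommMonoid E] (F : ℕ → E) (T : ℕ) :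
    ∑ t ∈ Finset.Icc 1 T, F (t - 1) = ∑ t ∈ Finset.range T, F t := by
  induction T with
  | zero => simp
  | succ n ih =>
    rw [Finset.sum_Icc_succ_top (by omega), ih, Finset.sum_range_succ, Nat.add_sub_cancel]

theorem integral_sum_coordinate {X : Type*} [MeasurableSpace X] [DiscreteMeasurableSpace X]
    {Q : Measure (ℕ → X)} [IsFiniteMeasure Q] {F : X → ℝ} {C : ℝ} (hF : ∀ x, |F x| ≤ C) (T : ℕ) :
    Integrable (fun ω => ∑ t ∈ Finset.Icc 1 T, F (ω (t - 1))) Q ∧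
      ∫ ω, ∑ t ∈ Finset.Icc 1 T, F (ω (t - 1)) ∂Q =
        ∑ t ∈ Finset.range T, ∫ ω, F (ω t) ∂Q := by
  have hi (t : ℕ) : Integrable (fun ω => F (ω t)) Q := integrable_coordinate hF t
  refine ⟨integrable_finsetSum _ fun t _ => hi (t - 1), ?_⟩
  rw [integral_finsetSum _ fun t _ => hi (t - 1), sum_Icc_sub_one fun t => ∫ ω, F (ω t) ∂Q]

end GoldenHandcuffs

/-! ### Assembly of the theorem. -/

open GoldenHandcuffs in
theorem theorem1 {A O N ι : Type*} [Countable A] [Countable O] [Countable N]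
    -- reward set and discount factor
    (R : Set ℝ) (hRc : R.Countable) (L : ℝ) (hL : 0 ≤ L) (hR : R ⊆ Set.Icc (-L) 1)
    (γ : ℝ) (hγ₀ : 0 < γ) (hγ₁ : γ < 1)
    -- models, prior weights, Bayesian mixture, true environment
    (M : N → Environment A O R) (w : N → ℝ≥0) (hw : ∀ n, 0 < w n)
    (hw₁ : ∑' n, (w n : ℝ≥0∞) ≤ 1)
    (ξ : Environment A O R) (hξ : ξ = mixture M w hw₁)
    (m : N) (μ : Environment A O R) (hμ : μ = M m) (hμ₁ : μ.IsProper)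
    -- mentors with their weights, optimizing policy, choice of a mentor at the safety trigger
    (mentor : ι → Policy A O R) (v : PMF ι)
    (πopt : Policy A O R) (hπopt : IsBayesOptimal γ ξ πopt)
    (yieldTo : Hist A O R → PMF ι)
    -- the Golden Handcuffs agent, and the law of its interaction with the true environment
    (GH : Agent A O R (RolloutState ι)) (hGH : GH = agentGH γ ξ πopt mentor v yieldTo)
    (P : Measure (ℕ → Node A O R (RolloutState ι))) (hP : P = law μ GH [] none)
    -- the true rewards are almost surely nonnegative
    (hpos : ∀ᵐ ω ∂P, ∀ t : ℕ, 1 ≤ t → 0 ≤ (ω t).reward) :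
    (∀ ε : ℝ, 0 < ε → ∀ T : ℕ,
      Integrable (fun ω => ∑ t ∈ Finset.Icc 1 T,
        (shortfall γ μ GH mentor v ε (ω (t - 1))) ^ 2) P ∧
      Integrable (fun ω => ∑ t ∈ Finset.Icc 1 T,
        (stateShortfall γ μ GH mentor v ε (ω (t - 1))) ^ 2) P ∧
      ∫ ω, ∑ t ∈ Finset.Icc 1 T, (shortfall γ μ GH mentor v ε (ω (t - 1))) ^ 2 ∂P
        ≤ ∫ ω, ∑ t ∈ Finset.Icc 1 T, (stateShortfall γ μ GH mentor v ε (ω (t - 1))) ^ 2 ∂P ∧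
      ∫ ω, ∑ t ∈ Finset.Icc 1 T, (stateShortfall γ μ GH mentor v ε (ω (t - 1))) ^ 2 ∂P
        ≤ 1 / (4 * (1 - γ)) * (T : ℝ) ^ (2 / 3 : ℝ) * Real.log T
          + 12 * (L + 1) ^ 2 / (1 - γ) ^ 2 * (T : ℝ) ^ (1 / 3 : ℝ)
          + 8 * L * (L + 1) ^ 2 / (1 - γ) ^ 3 * Real.log (1 / (w m : ℝ))
          + 4 * (L + 2) ^ 2 / ε ^ 2 * (T : ℝ) ^ (2 / 3 : ℝ) * Real.log (1 / (w m : ℝ))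
          + 6 * (L + 1) ^ 2 * (T : ℝ) ^ (2 / 3 : ℝ)) ∧
    (∀ ε : ℝ, 0 < ε →
      Tendsto (fun T : ℕ =>
        (∫ ω, (({t : ℕ | 1 ≤ t ∧ t ≤ T ∧
          FallsBehind γ μ GH mentor v (ε / Real.logb 2 T) ε (ω (t - 1))}.ncard : ℕ) : ℝ) ∂P)
          / (T : ℝ) ^ (2 / 3 + ε : ℝ)) atTop (𝓝 0)) := by
  subst hξ hμ hP
  have : Countable R := hRc.to_subtype
  have hP1 : IsProbabilityMeasure (law (M m) GH [] none) := by unfold law; infer_instance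
  have hpos' : ∀ t y, iter (step (M m) GH) t (.running [] none) y ≠ 0 → 0 ≤ y.reward := by
    intro t
    -- The hypothesis concerns t ≥ 1; at the start there is no reward yet and its default value is
    -- 0.
    rcases Nat.eq_zero_or_pos t with rfl | ht
    · intro y hy
      rw [← PMF.mem_support_iff, iter, PMF.mem_support_pure_iff] at hy
      rw [hy]
      exact le_rfl
    · have hae : ∀ᵐ ω ∂chainLaw (step (M m) GH) (.running [] none), 0 ≤ (ω t).reward := by
        filter_upwards [hpos] with ω hω using hω t ht
      exact (ae_chainLaw_iff (f := step (M m) GH) (x := .running [] none) (n := t)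
        (p := fun x => 0 ≤ x.reward)).1 hae
  have hlam : 0 ≤ Real.log (1 / (w m : ℝ)) :=
    Real.log_nonneg ((one_le_div (by exact_mod_cast hw m)).2 (weight_le_one hw₁))
  have hS (ε : ℝ) := abs_shortfall_sq_le hγ₀ hγ₁ hL hR (M m) GH mentor v ε
  have hSS (ε : ℝ) := abs_stateShortfall_sq_le hγ₀ hγ₁ hL hR (M m) GH mentor v ε
  have hle (ε : ℝ) (T : ℕ) :
      ∫ ω, ∑ t ∈ Finset.Icc 1 T, (shortfall γ (M m) GH mentor v ε (ω (t - 1))) ^ 2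
          ∂(law (M m) GH [] none) ≤
        ∫ ω, ∑ t ∈ Finset.Icc 1 T, (stateShortfall γ (M m) GH mentor v ε (ω (t - 1))) ^ 2
          ∂(law (M m) GH [] none) := by
    rw [(integral_sum_coordinate (hS ε) T).2, (integral_sum_coordinate (hSS ε) T).2]
    exact Finset.sum_le_sum fun t _ =>
      integral_shortfall_sq_le hγ₀ hγ₁ hL hR (M m) GH mentor v ε t
  have hbound (ε : ℝ) (hε : 0 < ε) (T : ℕ) :
      ∫ ω, ∑ t ∈ Finset.Icc 1 T, (stateShortfall γ (M m) GH mentor v ε (ω (t - 1))) ^ 2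
          ∂(law (M m) GH [] none) ≤
        shortfallBound γ L (Real.log (1 / (w m : ℝ))) ε T := by
    rw [(integral_sum_coordinate (hSS ε) T).2]
    refine (ENNReal.ofReal_le_ofReal_iff (shortfallBound_nonneg hγ₁ hL hlam ε T)).1 ?_
    refine le_trans (le_of_eq ?_) (sum_expect_stateShortfall_sq_le_bound hw₁ hγ₀ hγ₁ hL hR (hw m)
      hμ₁ hπopt hGH (mentor := mentor) (v := v) hpos' hε T)
    rw [ENNReal.ofReal_sum_of_nonneg fun t _ => integral_nonneg fun ω => sq_nonneg _]
    refine Finset.sum_congr rfl fun t _ => ?_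
    rw [ofReal_integral_eq_lintegral_ofReal (integrable_coordinate (hSS ε) t)
      (ae_of_all _ fun ω => sq_nonneg _), law,
      lintegral_chainLaw _ _ t fun x =>
        ENNReal.ofReal (stateShortfall γ (M m) GH mentor v ε x ^ 2)]
    congr 1
    funext x
    exact ENNReal.ofReal_pow (stateShortfall_nonneg hγ₀ hγ₁ hL hR (M m) GH mentor v ε x) 2
  refine ⟨fun ε hε T => ⟨(integral_sum_coordinate (hS ε) T).1,
    (integral_sum_coordinate (hSS ε) T).1, hle ε T, hbound ε hε T⟩, fun ε hε => ?_⟩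
  have hlim := (tendsto_shortfallBound γ L (Real.log (1 / (w m : ℝ))) hε).const_mul (1 / ε ^ 2)
  rw [mul_zero] at hlim
  refine tendsto_of_tendsto_of_tendsto_of_le_of_le' tendsto_const_nhds hlim
    (Eventually.of_forall fun T => ?_) ?_
  · exact div_nonneg (integral_nonneg fun ω => Nat.cast_nonneg _) (by positivity)
  -- From T = 2 on, log₂ T > 0, so the weight threshold is positive and the first part applies to
  -- it.
  filter_upwards [eventually_ge_atTop 2] with T hT
  have hδ : 0 < ε / Real.logb 2 T :=
    div_pos hε (Real.logb_pos one_lt_two (by exact_mod_cast hT))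
  rw [← mul_div_assoc]
  refine div_le_div_of_nonneg_right ?_ (by positivity)
  refine le_trans ?_ (mul_le_mul_of_nonneg_left ((hle _ T).trans (hbound _ hδ T)) (by positivity))
  rw [← integral_const_mul]
  refine integral_mono_of_nonneg (ae_of_all _ fun ω => Nat.cast_nonneg _)
    ((integral_sum_coordinate (hS _) T).1.const_mul _) (ae_of_all _ fun ω => ?_)
  classical
  have hset : {t : ℕ | 1 ≤ t ∧ t ≤ T ∧
      FallsBehind γ (M m) GH mentor v (ε / Real.logb 2 T) ε (ω (t - 1))} =
      ((Finset.Icc 1 T).filter fun t =>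
        FallsBehind γ (M m) GH mentor v (ε / Real.logb 2 T) ε (ω (t - 1)) : Finset ℕ) := by
    ext t
    simp [and_assoc]
  simp only
  rw [hset, Set.ncard_coe_finset, Finset.card_filter, Nat.cast_sum, Finset.mul_sum]
  refine Finset.sum_le_sum fun t _ => ?_
  -- Markov's inequality, pointwise: on the event the shortfall is at least ε, so the indicator is
  -- at most its square over ε².
  split_ifs with hfb
  · rw [Nat.cast_one, one_div, inv_mul_eq_div, one_le_div (by positivity)]
    refine pow_le_pow_left₀ hε.le ?_ 2
    rcases hx : ω (t - 1) with _ | ⟨h, σ⟩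
    · rw [hx] at hfb
      exact hfb.elim
    · rw [hx] at hfb
      obtain ⟨i, hi, hi'⟩ := hfb
      refine hi'.trans (sub_le_sub_right ?_ _)
      exact le_csSup (bddAbove_shortfall hγ₀ hγ₁ hL hR (M m) GH mentor v _ h)
        (Set.mem_insert_of_mem _ ⟨i, hi, rfl⟩)
  · rw [Nat.cast_zero]
    positivity
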